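/- For $s\in\mathbb{C}$ consider the double series $$\omega_B(s)=\sum_{m,n\ge 1}\frac{1}{m^s n^s (m+n)^s (m+2n)^s},\qquad \omega_G(s)=\sum_{m,n\ge 1}\frac{1}{m^s n^s (m+n)^s (m+2n)^s (m+3n)^s (2m+3n)^s}.$$ They converge absolutely for $\operatorname{Re}(s)>\tfrac12$ and $\operatorname{Re}(s)>\tfrac13$ respectively, and have meromorphic continuations to all of $\mathbb{C}$, denoted by the same symbols. (Poles are understood up to removable singularities.) (a) The poles of $\omega_B$ are exactly the point $s=\tfrac12$ and the points $s=\tfrac{k}{3}$ with $k\in\mathbb{Z}$, $k\le 1$, $k\equiv 1,5 \pmod 6$. All of them are simple. At each point $s=\tfrac k3$ with $k\in\mathbb{Z}$, $k\le 1$, $k\not\equiv 1,5\pmod 6$, the residue of $\omega_B$ is $0$. (b) $\omega_G$ has a pole at $s=\tfrac13$, and every other pole of $\omega_G$ is among the points $s=\tfrac{k}{5}$ with $k\in\mathbb{Z}$, $k\le 1$, $k\equiv 1,3,7,9 \pmod{10}$ (it is not asserted that each of these points is a pole). All poles are simple. At each point $s=\tfrac k5$ with $k\in\mathbb{Z}$,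 $k\le 1$, $k\not\equiv 1,3,7,9\pmod{10}$, the residue of $\omega_G$ is $0$. -/

import Mathlib

/-- The `(m, n)`-term of the double series
`ω_B(s) = ∑_{m, n ≥ 1} 1 / (m^s n^s (m+n)^s (m+2n)^s)`. -/
noncomputable def omegaBTerm (s : ℂ) (p : ℕ+ × ℕ+) : ℂ :=
  1 / ((p.1 : ℂ) ^ s * (p.2 : ℂ) ^ s * ((p.1 : ℂ) + (p.2 : ℂ)) ^ s
    * ((p.1 : ℂ) + 2 * (p.2 : ℂ)) ^ s)

/-- The `(m, n)`-term of the double series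
`ω_G(s) = ∑_{m, n ≥ 1} 1 / (m^s n^s (m+n)^s (m+2n)^s (m+3n)^s (2m+3n)^s)`. -/
noncomputable def omegaGTerm (s : ℂ) (p : ℕ+ × ℕ+) : ℂ :=
  1 / ((p.1 : ℂ) ^ s * (p.2 : ℂ) ^ s * ((p.1 : ℂ) + (p.2 : ℂ)) ^ s
    * ((p.1 : ℂ) + 2 * (p.2 : ℂ)) ^ s * ((p.1 : ℂ) + 3 * (p.2 : ℂ)) ^ s
    * (2 * (p.1 : ℂ) + 3 * (p.2 : ℂ)) ^ s)

/-- `W` is a meromorphic continuation to the whole plane of the double series with terms `a s p`,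
which converges (unconditionally, hence absolutely) to `W s` for `Re s > σ`. -/
def IsMeromorphicContinuation (a : ℂ → ℕ+ × ℕ+ → ℂ) (σ : ℝ) (W : ℂ → ℂ) : Prop :=
  MeromorphicOn W Set.univ ∧ ∀ s : ℂ, σ < s.re → HasSum (a s) (W s)

/-- `s₀` is a pole of `W`. -/
def IsPoleAt (W : ℂ → ℂ) (s₀ : ℂ) : Prop :=
  MeromorphicAt W s₀ ∧ meromorphicOrderAt W s₀ < 0

/-- `s₀` is a pole of `W` of order exactly one. -/
def IsSimplePoleAt (W : ℂ → ℂ) (s₀ : ℂ) : Prop :=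
  MeromorphicAt W s₀ ∧ meromorphicOrderAt W s₀ = ((-1 : ℤ) : WithTop ℤ)

/-- `W` has residue `r` at `s₀`: the normalised integral of `W` over every sufficiently small
positively oriented circle around `s₀` equals `r`. -/
def HasResidueAt (W : ℂ → ℂ) (s₀ r : ℂ) : Prop :=
  ∀ᶠ ρ : ℝ in nhdsWithin 0 (Set.Ioi 0),
    (2 * (Real.pi : ℂ) * Complex.I)⁻¹ * (∮ z in C(s₀, ρ), W z) = r

/-- The integers `k ≤ 1` with `k ≡ 1, 5 (mod 6)`. -/
def IndexB (k : ℤ) : Prop :=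
  k ≤ 1 ∧ (k ≡ 1 [ZMOD 6] ∨ k ≡ 5 [ZMOD 6])

/-- The integers `k ≤ 1` with `k ≡ 1, 3, 7, 9 (mod 10)`. -/
def IndexG (k : ℤ) : Prop :=
  k ≤ 1 ∧ (k ≡ 1 [ZMOD 10] ∨ k ≡ 3 [ZMOD 10] ∨ k ≡ 7 [ZMOD 10] ∨ k ≡ 9 [ZMOD 10])

/-!
Both series have the shape `∑ P (m, n) ^ (-s)`, where `P` is a product of `D = d + 1` linear forms
that is positive in the open quadrant and vanishes on its two edges (`d = 3` for `ω_B` and `d = 5`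
for `ω_G`). Convergence for `Re s > 2 / D` follows from `(m n) ^ (D / 2) ≤ P (m, n)`.

For the continuation the quadrant is divided into two cones, one around each edge, by a smooth
partition of unity in `m / (m + n)`. In the cone around the edge `n = 0` the sum over `m` is taken
first. After the cutoff the summand `n ^ (-D s) f (m / n)` vanishes for `m / n` near `0`, so the
Euler–Maclaurin formula has no boundary terms (`tsum_eq_integral_add_bernoulli`) and the sum over
the cone becomes (`EdgeData.tsum_term_eq`)
`ζ (D s - 1) * J s + R s`, with `J s = ∫ x in (0, ∞), f x`.
The `K`-th derivative of `f` is `O (x ^ (-d s - K))`, so the remainder `R` is holomorphic in a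
half-plane that grows with `K` (`EdgeData.differentiableOn_rem`). The derivative bounds come from
writing `f` as `u ^ (-d s)` times a smooth function of `v = u⁻¹`, where `u = x + a`: each derivative
produces one more factor `v` and a function of the same kind (`EdgeData.Symbol`).

The poles of `J` come from the expansion of `f` at infinity. With a suitable centre `a` the forms
that do not vanish on the edge are symmetric about `u = 0`, so that this expansion only contains
the powers `u ^ (-d s - 2 i)`, and `J` has at most simple poles, at `d s = 1 - 2 i`
(`EdgeData.J_eq`). The residue there is `1 / d` times the `i`-th coefficient of the expansion
(`EdgeData.coef`), which is built from binomial coefficients and vanishes when `s` is a negative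
integer, since then `P ^ (-s)` is a polynomial of too small a degree. The remaining pole, at
`s = 2 / D`, is that of `ζ (D s - 1)`; there `J` is the integral of a nonnegative function that is
not zero (`EdgeData.J_re_pos`).

For `ω_B` the coefficients of the two edges are positive multiples of the same binomial
coefficient, so the residue vanishes only where that coefficient or `ζ (4 s - 1)` does. The values
of `ζ` that occur are `ζ (1 / 3)`, which is negative by
`ζ s = s / (s - 1) - s * ∫ {t} t ^ (-s - 1)`, and values at negative non-integers, which are
nonzero by the functional equation.
-/

open Filter Topology MeasureTheory Set
open scoped ContDiff

/-! ### Holomorphy of parametric integrals -/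

/-- An integral depending on a complex parameter is holomorphic as soon as its integrand is
holomorphic and dominated; Cauchy's estimate supplies the bound on the derivative. -/
theorem differentiableOn_integral_of_dominated {α : Type*} [MeasurableSpace α] {μ : Measure α}
    {φ : ℂ → α → ℂ} {U : Set ℂ} (hU : IsOpen U)
    (hm : ∀ s ∈ U, AEStronglyMeasurable (φ s) μ)
    (hd : ∀ᵐ x ∂μ, DifferentiableOn ℂ (fun s => φ s x) U) {b : α → ℝ} (hb : Integrable b μ)
    (hle : ∀ᵐ x ∂μ, ∀ s ∈ U, ‖φ s x‖ ≤ b x) :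
    DifferentiableOn ℂ (fun s => ∫ x, φ s x ∂μ) U := by
  intro s₀ hs₀
  obtain ⟨r, hr, hrU⟩ := Metric.isOpen_iff.1 hU s₀ hs₀
  have hr3 : 0 < r / 3 := by positivity
  have hsub : ∀ s ∈ Metric.ball s₀ (r / 3), Metric.closedBall s (r / 3) ⊆ U := by
    intro s hs z hz
    apply hrU
    rw [Metric.mem_ball] at hs ⊢
    rw [Metric.mem_closedBall] at hz
    linarith [dist_triangle z s s₀]
  have hball : Metric.ball s₀ (r / 3) ⊆ U := fun s hs =>
    hsub s hs (Metric.mem_closedBall_self hr3.le)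
  have hderiv : ∀ᵐ x ∂μ, ∀ s ∈ Metric.ball s₀ (r / 3),
      HasDerivAt (fun s => φ s x) (deriv (fun s => φ s x) s) s := by
    filter_upwards [hd] with x hx s hs
    exact ((hx s (hball hs)).differentiableAt (hU.mem_nhds (hball hs))).hasDerivAt
  have hs₀b : s₀ ∈ Metric.ball s₀ (r / 3) := Metric.mem_ball_self hr3
  have hseq : ∃ u : ℕ → ℂ, (∀ n, u n ∈ Metric.ball s₀ (r / 3)) ∧ Tendsto u atTop (𝓝[≠] s₀) := by
    have h1 : Metric.ball s₀ (r / 3) ∈ 𝓝[≠] s₀ :=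
      mem_nhdsWithin_of_mem_nhds (Metric.ball_mem_nhds _ hr3)
    obtain ⟨u, hu⟩ := exists_seq_tendsto (𝓝[≠] s₀)
    obtain ⟨N, hN⟩ := eventually_atTop.1 (hu.eventually h1)
    exact ⟨fun n => u (n + N), fun n => hN _ (Nat.le_add_left _ _),
      hu.comp (tendsto_add_atTop_nat N)⟩
  obtain ⟨u, hu, hut⟩ := hseq
  -- The derivative is measurable as a limit of difference quotients.
  have hmeas : AEStronglyMeasurable (fun x => deriv (fun s => φ s x) s₀) μ := by
    refine aestronglyMeasurable_of_tendsto_ae atTop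
      (f := fun n x => slope (fun s => φ s x) s₀ (u n)) (fun n => ?_) ?_
    · simp only [slope_def_module]
      exact ((hm _ (hball (hu n))).sub (hm _ hs₀)).const_smul (u n - s₀)⁻¹
    · filter_upwards [hderiv] with x hx
      exact (hasDerivAt_iff_tendsto_slope.1 (hx s₀ hs₀b)).comp hut
  have key := hasDerivAt_integral_of_dominated_loc_of_deriv_le (μ := μ) (F := φ)
    (F' := fun s x => deriv (fun s => φ s x) s) (x₀ := s₀) (s := Metric.ball s₀ (r / 3))
    (bound := fun x => b x / (r / 3)) (Metric.ball_mem_nhds _ hr3)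
    (by filter_upwards [hU.mem_nhds hs₀] with s hs using hm s hs)
    (hb.mono' (hm _ hs₀) (by filter_upwards [hle] with x hx using hx _ hs₀)) hmeas
    (by
      filter_upwards [hle, hd] with x hx hdx s hs
      refine Complex.norm_deriv_le_of_forall_mem_sphere_norm_le hr3 ?_ ?_
      · refine DifferentiableOn.diffContOnCl ?_
        rw [closure_ball _ hr3.ne']
        exact hdx.mono (hsub s hs)
      · intro z hz
        exact hx z (hsub s hs (Metric.sphere_subset_closedBall hz)))
    (hb.div_const _) hderiv
  exact key.2.differentiableAt.differentiableWithinAt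

/-! ### Euler–Maclaurin summation on the half-line -/

theorem exists_bound_bernoulliFun_fract (k : ℕ) :
    ∃ C : ℝ, 0 ≤ C ∧ ∀ t : ℝ, ‖((bernoulliFun k (Int.fract t) : ℝ) : ℂ)‖ ≤ C := by
  obtain ⟨C, hC⟩ := (isCompact_Icc (a := (0 : ℝ)) (b := 1)).exists_bound_of_continuousOn
    (continuous_bernoulliFun k).continuousOn
  have h : ∀ t : ℝ, ‖((bernoulliFun k (Int.fract t) : ℝ) : ℂ)‖ ≤ C := fun t => by
    rw [Complex.norm_real]
    exact hC _ ⟨Int.fract_nonneg t, (Int.fract_lt_one t).le⟩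
  exact ⟨C, (norm_nonneg _).trans (h 0), h⟩

theorem measurable_bernoulliFun_fract (k : ℕ) :
    Measurable fun t : ℝ => ((bernoulliFun k (Int.fract t) : ℝ) : ℂ) :=
  Complex.measurable_ofReal.comp ((continuous_bernoulliFun k).measurable.comp measurable_fract)

theorem integrableOn_bernoulliFun_fract_mul (k : ℕ) {g : ℝ → ℂ} {S : Set ℝ}
    (hg : IntegrableOn g S) :
    IntegrableOn (fun t => ((bernoulliFun k (Int.fract t) : ℝ) : ℂ) * g t) S := by
  obtain ⟨C, -, hC⟩ := exists_bound_bernoulliFun_fract k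
  exact hg.bdd_mul (c := C) (measurable_bernoulliFun_fract k).aestronglyMeasurable
    (Eventually.of_forall hC)

/-- Integration by parts against a Bernoulli polynomial on a unit interval. -/
theorem integral_bernoulliFun_fract_mul_unit (k m : ℕ) {g g' : ℝ → ℂ}
    (hg : ∀ t : ℝ, 0 ≤ t → HasDerivAt g (g' t) t) (hg' : ContinuousOn g' (Ici 0)) :
    ∫ t in (m : ℝ)..(m + 1 : ℕ), ((bernoulliFun k (Int.fract t) : ℝ) : ℂ) * g t =
      ((bernoulliFun (k + 1) 1 : ℝ) * g (m + 1 : ℕ) - (bernoulliFun (k + 1) 0 : ℝ) * g m) / (k + 1)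
      - (∫ t in (m : ℝ)..(m + 1 : ℕ),
          ((bernoulliFun (k + 1) (Int.fract t) : ℝ) : ℂ) * g' t) / (k + 1) := by
  have hle : (m : ℝ) ≤ (m + 1 : ℕ) := by push_cast; linarith
  -- On the interval `fract t = t - m`, except at the right endpoint.
  have hcongr : ∀ (j : ℕ) (f : ℝ → ℂ),
      ∫ t in (m : ℝ)..(m + 1 : ℕ), ((bernoulliFun j (Int.fract t) : ℝ) : ℂ) * f t =
      ∫ t in (m : ℝ)..(m + 1 : ℕ), f t * ((bernoulliFun j (t - m) : ℝ) : ℂ) := by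
    intro j f
    refine intervalIntegral.integral_congr_ae ?_
    have hne : ∀ᵐ t : ℝ, t ≠ (m + 1 : ℕ) := by
      simp [ae_iff, measure_singleton]
    filter_upwards [hne] with t ht htm
    rw [uIoc_of_le hle] at htm
    have h1 : t < (m + 1 : ℕ) := lt_of_le_of_ne htm.2 ht
    have : Int.fract t = t - m := by
      rw [Int.fract_eq_iff]
      refine ⟨by linarith [htm.1], ?_, m, by simp⟩
      push_cast at h1; linarith
    rw [this, mul_comm]
  rw [hcongr, hcongr]
  have hsub : uIcc (m : ℝ) (m + 1 : ℕ) ⊆ Ici 0 := by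
    rw [uIcc_of_le hle]; intro t ht; exact (Nat.cast_nonneg m).trans ht.1
  have hv : ∀ t : ℝ, HasDerivAt
      (fun t : ℝ => ((bernoulliFun (k + 1) (t - m) : ℝ) : ℂ) / (k + 1))
      ((bernoulliFun k (t - m) : ℝ) : ℂ) t := by
    intro t
    have h1 := (antideriv_bernoulliFun k (t - m)).comp_sub_const t m
    have h2 := h1.ofReal_comp
    simpa using h2
  have hc : Continuous fun t : ℝ => ((bernoulliFun k (t - m) : ℝ) : ℂ) := by
    have := continuous_bernoulliFun k
    fun_prop
  have key := intervalIntegral.integral_mul_deriv_eq_deriv_mul (a := (m : ℝ)) (b := (m + 1 : ℕ))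
    (u := g) (u' := g') (v := fun t : ℝ => ((bernoulliFun (k + 1) (t - m) : ℝ) : ℂ) / (k + 1))
    (v' := fun t : ℝ => ((bernoulliFun k (t - m) : ℝ) : ℂ))
    (fun t ht => hg t (hsub ht)) (fun t _ => hv t)
    ((hg'.mono hsub).intervalIntegrable) (hc.intervalIntegrable _ _)
  rw [key]
  have e1 : ((m + 1 : ℕ) : ℝ) - m = 1 := by push_cast; ring
  simp only [e1, sub_self]
  rw [← intervalIntegral.integral_div]
  congr 1
  · ring
  · refine intervalIntegral.integral_congr fun t _ => ?_
    ring

/-- Euler–Maclaurin summation on `[0, ∞)` to arbitrary order, for a function all of whose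
derivatives `g k` vanish at `0` and are integrable, so that there are no boundary terms. -/
theorem tsum_eq_integral_add_bernoulli {g : ℕ → ℝ → ℂ}
    (hg : ∀ k, ∀ t : ℝ, 0 ≤ t → HasDerivAt (g k) (g (k + 1) t) t) (h0 : ∀ k, g k 0 = 0)
    (hint : ∀ k, IntegrableOn (g k) (Ioi 0)) (hsum : Summable fun m : ℕ => g 0 (m + 1 : ℕ))
    (K : ℕ) :
    ∑' m : ℕ, g 0 (m + 1 : ℕ) = (∫ t in Ioi (0 : ℝ), g 0 t) +
      (-1) ^ K / (K + 1).factorial *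
        ∫ t in Ioi (0 : ℝ), ((bernoulliFun (K + 1) (Int.fract t) : ℝ) : ℂ) * g (K + 1) t := by
  have hcont : ∀ k, ContinuousOn (g k) (Ici 0) := fun k t ht =>
    (hg k t ht).continuousAt.continuousWithinAt
  have hlim : ∀ k, Tendsto (fun M : ℕ => g k (M : ℝ)) atTop (𝓝 0) := fun k =>
    (tendsto_zero_of_hasDerivAt_of_integrableOn_Ioi (a := 0)
      (fun t ht => hg k t (le_of_lt ht)) (hint (k + 1)) (hint k)).comp tendsto_natCast_atTop_atTop
  set I : ℕ → ℂ := fun k =>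
    ∫ t in Ioi (0 : ℝ), ((bernoulliFun k (Int.fract t) : ℝ) : ℂ) * g k t with hI
  have hA : ∀ k, Tendsto (fun M : ℕ =>
      ∫ t in (0 : ℝ)..(M : ℝ), ((bernoulliFun k (Int.fract t) : ℝ) : ℂ) * g k t) atTop
      (𝓝 (I k)) := fun k =>
    intervalIntegral_tendsto_integral_Ioi 0
      (integrableOn_bernoulliFun_fract_mul k (hint k)) tendsto_natCast_atTop_atTop
  -- Integration by parts over `[0, M]`. The boundary terms at interior integers cancel except for
  -- `k = 0`, because `B₁ 1 = B₁ 0 + 1` while `Bⱼ 1 = Bⱼ 0` for `j ≠ 1`.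
  have hfin : ∀ k M : ℕ,
      ∫ t in (0 : ℝ)..(M : ℝ), ((bernoulliFun k (Int.fract t) : ℝ) : ℂ) * g k t =
      (bernoulliFun (k + 1) 0 : ℝ) / (k + 1) * g k M
        + (if k = 0 then ∑ m ∈ Finset.range M, g 0 (m + 1 : ℕ) else 0)
        - (∫ t in (0 : ℝ)..(M : ℝ),
            ((bernoulliFun (k + 1) (Int.fract t) : ℝ) : ℂ) * g (k + 1) t) / (k + 1) := by
    intro k M
    have hii : ∀ (j : ℕ) (f : ℝ → ℂ), IntegrableOn f (Ioi 0) → ∀ m : ℕ,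
        IntervalIntegrable (fun t => ((bernoulliFun j (Int.fract t) : ℝ) : ℂ) * f t) volume
          (m : ℝ) (m + 1 : ℕ) := by
      intro j f hf m
      rw [intervalIntegrable_iff_integrableOn_Ioc_of_le (by push_cast; linarith)]
      refine integrableOn_bernoulliFun_fract_mul j (hf.mono_set ?_)
      intro t ht
      exact lt_of_le_of_lt (Nat.cast_nonneg m) ht.1
    induction M with
    | zero => simp [h0]
    | succ M ih =>
      have hadd : ∀ (j : ℕ) (f : ℝ → ℂ), IntegrableOn f (Ioi 0) →
          ∫ t in (0 : ℝ)..((M + 1 : ℕ) : ℝ), ((bernoulliFun j (Int.fract t) : ℝ) : ℂ) * f t =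
          (∫ t in (0 : ℝ)..(M : ℝ), ((bernoulliFun j (Int.fract t) : ℝ) : ℂ) * f t) +
          ∫ t in (M : ℝ)..((M + 1 : ℕ) : ℝ), ((bernoulliFun j (Int.fract t) : ℝ) : ℂ) * f t := by
        intro j f hf
        rw [intervalIntegral.integral_add_adjacent_intervals _ (hii j f hf M)]
        rw [intervalIntegrable_iff_integrableOn_Ioc_of_le (Nat.cast_nonneg M)]
        exact integrableOn_bernoulliFun_fract_mul j (hf.mono_set Ioc_subset_Ioi_self)
      rw [hadd k _ (hint k), hadd (k + 1) _ (hint (k + 1)), ih,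
        integral_bernoulliFun_fract_mul_unit k M (hg k) (hcont (k + 1)), bernoulliFun_eval_one]
      have hk : (k : ℂ) + 1 ≠ 0 := Nat.cast_add_one_ne_zero k
      by_cases hk0 : k = 0
      · subst hk0
        simp only [Finset.sum_range_succ, if_true]
        push_cast
        simp only [zero_add]
        ring
      · have : k + 1 ≠ 1 := by omega
        simp only [hk0, this, if_false]
        push_cast
        ring
  have hrec : ∀ k, I k = (if k = 0 then ∑' m : ℕ, g 0 (m + 1 : ℕ) else 0) - I (k + 1) / (k + 1) := by
    intro k
    refine tendsto_nhds_unique (hA k) (Tendsto.congr (fun M => (hfin k M).symm) ?_)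
    have h1 := ((hlim k).const_mul ((bernoulliFun (k + 1) 0 : ℝ) / (k + 1) : ℂ))
    rw [mul_zero] at h1
    have h2 : Tendsto (fun M : ℕ =>
        if k = 0 then ∑ m ∈ Finset.range M, g 0 (m + 1 : ℕ) else 0) atTop
        (𝓝 (if k = 0 then ∑' m : ℕ, g 0 (m + 1 : ℕ) else 0)) := by
      split_ifs
      · exact hsum.hasSum.tendsto_sum_nat
      · exact tendsto_const_nhds
    have h3 := (h1.add h2).sub ((hA (k + 1)).div_const ((k : ℂ) + 1))
    simpa using h3
  -- Iterating the recursion for `k ≥ 1` produces the factor `(-1) ^ K / (K + 1)!`.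
  have hpow : ∀ K : ℕ, I 1 = (-1) ^ K / (K + 1).factorial * I (K + 1) := by
    intro K
    induction K with
    | zero => simp
    | succ K ih =>
      rw [ih, hrec (K + 1), if_neg (Nat.succ_ne_zero K), Nat.factorial_succ (K + 1)]
      have : ((K + 1).factorial : ℂ) ≠ 0 := Nat.cast_ne_zero.2 (Nat.factorial_ne_zero _)
      have h2 : ((K : ℂ) + 1 + 1) ≠ 0 := by exact_mod_cast Nat.succ_ne_zero (K + 1)
      push_cast
      field_simp
      ring
  have h0' := hrec 0
  have hI0 : I 0 = ∫ t in Ioi (0 : ℝ), g 0 t := by simp [hI]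
  rw [if_pos rfl] at h0'
  rw [← hI0, ← hpow K, h0']
  simp

/-! ### Edge data and symbols -/

/-- The data of one edge of the quadrant `m, n > 0`: after division by the power of `n` that
homogeneity dictates, the product of the linear forms is `u ^ d * r (u⁻²)`, where `u = m / n + a`
and `r w = C * (1 - b₁ * w) * (1 - b₂ * w)`. That only even powers of `u⁻¹` occur is the symmetry
of the arrangement of roots about `u = 0`. -/
structure EdgeData where
  /-- the number of linear forms other than the one that vanishes along the edge -/
  d : ℕ
  /-- the centre of symmetry -/
  a : ℝ
  /-- the leading coefficient -/
  C : ℝ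
  /-- the first coefficient of `r` -/
  b₁ : ℝ
  /-- the second coefficient of `r` -/
  b₂ : ℝ
  d_pos : 0 < d
  half_le_a : 1 / 2 ≤ a
  a_le : a ≤ 2
  C_pos : 0 < C
  b₁_nonneg : 0 ≤ b₁
  b₁_le : b₁ ≤ a ^ 2
  b₂_nonneg : 0 ≤ b₂
  b₂_le : b₂ ≤ a ^ 2

namespace EdgeData

variable (E : EdgeData)

theorem a_pos : 0 < E.a := by linarith [E.half_le_a]

/-- The value of `v = u⁻¹` at `m / n = 1 / 2`; the cutoff is supported on `v ≤ V`. -/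
noncomputable def V : ℝ := 1 / (E.a + 1 / 2)

/-- The function `v ↦ log r (v²)`. -/
noncomputable def logR (v : ℝ) : ℝ := Real.log (E.C * (1 - E.b₁ * v ^ 2) * (1 - E.b₂ * v ^ 2))

/-- The cutoff to the cone around the edge, in the variable `v = u⁻¹`. Where `v < 1 / a` it is the
smooth transition function at `3 * m / (m + n) - 1`. -/
noncomputable def cutoff (v : ℝ) : ℝ :=
  if v < 1 / E.a then Real.smoothTransition (3 * (1 - E.a * v) / (1 + (1 - E.a) * v) - 1) else 0

theorem V_lt : E.V < 1 / E.a := by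
  have := E.a_pos
  unfold V
  gcongr
  linarith

theorem V_pos : 0 < E.V := by
  have := E.a_pos
  unfold V; positivity

/-- Both factors of `r (v ^ 2)` stay positive up to `v = 1 / a`, that is `m / n = 0`. The lower
bound `-1/2` on `v` only serves to have an open interval around `v = 0`. -/
theorem r_factor_pos {b v : ℝ} (hb : b ≤ E.a ^ 2) (h1 : -(1 / 2) < v) (h2 : v < 1 / E.a) :
    0 < 1 - b * v ^ 2 := by
  have ha := E.a_pos
  have h3 : E.a * v < 1 := by
    rw [lt_div_iff₀ ha] at h2; linarith
  have h4 : -1 < E.a * v := by nlinarith [E.a_le]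
  have h5 : (E.a * v) ^ 2 < 1 := by nlinarith
  nlinarith [sq_nonneg v]

theorem r_pos {v : ℝ} (h1 : -(1 / 2) < v) (h2 : v < 1 / E.a) :
    0 < E.C * (1 - E.b₁ * v ^ 2) * (1 - E.b₂ * v ^ 2) :=
  mul_pos (mul_pos E.C_pos (E.r_factor_pos E.b₁_le h1 h2)) (E.r_factor_pos E.b₂_le h1 h2)

theorem contDiffOn_logR : ContDiffOn ℝ ∞ E.logR (Ioo (-(1 / 2)) (1 / E.a)) := by
  unfold logR
  refine ContDiffOn.log (by fun_prop) ?_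
  intro v hv
  exact (E.r_pos hv.1 hv.2).ne'

theorem cutoff_denom_pos {v : ℝ} (h1 : -(1 / 2) < v) (h2 : v < 1 / E.a) :
    0 < 1 + (1 - E.a) * v := by
  have ha := E.a_pos
  rw [lt_div_iff₀ ha] at h2
  nlinarith [E.a_le, E.half_le_a]

theorem contDiffOn_cutoff : ContDiffOn ℝ ∞ E.cutoff (Ioo (-(1 / 2)) (1 / E.a)) := by
  have h : ContDiffOn ℝ ∞
      (fun v => Real.smoothTransition (3 * (1 - E.a * v) / (1 + (1 - E.a) * v) - 1))
      (Ioo (-(1 / 2)) (1 / E.a)) := by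
    refine Real.smoothTransition.contDiff.comp_contDiffOn ?_
    refine ContDiffOn.sub (ContDiffOn.div (by fun_prop) (by fun_prop) ?_) contDiffOn_const
    intro v hv
    exact (E.cutoff_denom_pos hv.1 hv.2).ne'
  refine h.congr fun v hv => ?_
  rw [cutoff, if_pos hv.2]

theorem cutoff_eq_zero {v : ℝ} (hv : E.V < v) : E.cutoff v = 0 := by
  unfold cutoff
  split_ifs with h
  · refine Real.smoothTransition.zero_of_nonpos ?_
    have hp := E.V_pos
    have hd := E.cutoff_denom_pos (by linarith) h
    rw [sub_nonpos, div_le_one hd]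
    unfold V at hv
    rw [div_lt_iff₀ (by linarith [E.a_pos])] at hv
    linarith
  · rfl

theorem cutoff_eq_one {v : ℝ} (hv0 : 0 ≤ v) (hv : v ≤ 1 / (E.a + 2)) : E.cutoff v = 1 := by
  have ha := E.a_pos
  have hlt : v < 1 / E.a := hv.trans_lt (by gcongr; linarith)
  rw [cutoff, if_pos hlt]
  refine Real.smoothTransition.one_of_one_le ?_
  have hd := E.cutoff_denom_pos (by linarith) hlt
  rw [le_sub_iff_add_le, le_div_iff₀ hd]
  rw [le_div_iff₀ (by linarith)] at hv
  linarith

theorem cutoff_nonneg (v : ℝ) : 0 ≤ E.cutoff v := by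
  unfold cutoff
  split_ifs
  · exact Real.smoothTransition.nonneg _
  · exact le_rfl

/-- A smooth function of `v > -1/2` that vanishes beyond the support of the cutoff. -/
def IsBump (h : ℝ → ℂ) : Prop :=
  ContDiffOn ℝ ∞ h (Ioi (-(1 / 2))) ∧ ∀ v, E.V < v → h v = 0

variable {E}

theorem IsBump.deriv {h : ℝ → ℂ} (hh : E.IsBump h) : E.IsBump (deriv h) := by
  refine ⟨hh.1.deriv_of_isOpen isOpen_Ioi (by norm_num), fun v hv => ?_⟩
  have : h =ᶠ[𝓝 v] fun _ => 0 := by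
    filter_upwards [isOpen_Ioi.mem_nhds (show v ∈ Ioi E.V from hv)] with w hw using hh.2 w hw
  rw [this.deriv_eq]; simp

/-- Beyond the support no smoothness needs to be checked; `logR` is singular at `1 / a`. -/
theorem isBump_of_contDiffOn_Ioo {h : ℝ → ℂ} (h1 : ContDiffOn ℝ ∞ h (Ioo (-(1 / 2)) (1 / E.a)))
    (h2 : ∀ v, E.V < v → h v = 0) : E.IsBump h := by
  refine ⟨fun v hv => ?_, h2⟩
  by_cases hva : v < 1 / E.a
  · exact (h1.contDiffAt (isOpen_Ioo.mem_nhds ⟨hv, hva⟩)).contDiffWithinAt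
  · have hv' : E.V < v := E.V_lt.trans_le (not_lt.1 hva)
    have : h =ᶠ[𝓝 v] fun _ => 0 := by
      filter_upwards [isOpen_Ioi.mem_nhds (show v ∈ Ioi E.V from hv')] with w hw using h2 w hw
    exact (contDiffAt_const.congr_of_eventuallyEq this).contDiffWithinAt

theorem IsBump.mul {μ h : ℝ → ℂ} (hμ : ContDiffOn ℝ ∞ μ (Ioo (-(1 / 2)) (1 / E.a)))
    (hh : E.IsBump h) : E.IsBump fun v => μ v * h v := by
  refine isBump_of_contDiffOn_Ioo (hμ.mul (hh.1.mono fun v hv => hv.1)) fun v hv => ?_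
  simp [hh.2 v hv]

variable (E) in
theorem isBump_cutoff : E.IsBump fun v => (E.cutoff v : ℂ) :=
  isBump_of_contDiffOn_Ioo (Complex.ofRealCLM.contDiff.comp_contDiffOn E.contDiffOn_cutoff)
    fun v hv => by simp [E.cutoff_eq_zero hv]

theorem IsBump.hasDerivAt {h : ℝ → ℂ} (hh : E.IsBump h) {v : ℝ} (hv : -(1 / 2) < v) :
    HasDerivAt h (_root_.deriv h v) v :=
  ((hh.1.contDiffAt (isOpen_Ioi.mem_nhds hv)).differentiableAt (by simp)).hasDerivAt

variable (E)

/-- Symbols: functions of `(s, v)` that are `exp (-s * logR v)` times a polynomial in `s` whose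
coefficients are smooth in `v` and supported in `v ≤ V`. -/
inductive Symbol : (ℂ → ℝ → ℂ) → Prop
  | base {h : ℝ → ℂ} (hh : E.IsBump h) : Symbol fun s v => Complex.exp (-s * E.logR v) * h v
  | add {H H' : ℂ → ℝ → ℂ} (hH : Symbol H) (hH' : Symbol H') :
      Symbol fun s v => H s v + H' s v
  | smul {H : ℂ → ℝ → ℂ} (hH : Symbol H) : Symbol fun s v => s * H s v

variable {E}

theorem Symbol.congr {H H' : ℂ → ℝ → ℂ} (hH : E.Symbol H) (h : ∀ s v, H' s v = H s v) :
    E.Symbol H' := by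
  have : H' = H := funext fun s => funext fun v => h s v
  rwa [this]

theorem Symbol.mul {H : ℂ → ℝ → ℂ} (hH : E.Symbol H) {μ : ℝ → ℂ}
    (hμ : ContDiffOn ℝ ∞ μ (Ioo (-(1 / 2)) (1 / E.a))) :
    E.Symbol fun s v => μ v * H s v := by
  induction hH with
  | base hh => exact (Symbol.base (hh.mul hμ)).congr fun s v => by ring
  | add _ _ h1 h2 => exact (h1.add h2).congr fun s v => by ring
  | smul _ h => exact h.smul.congr fun s v => by ring

theorem Symbol.eq_zero {H : ℂ → ℝ → ℂ} (hH : E.Symbol H) (s : ℂ) {v : ℝ} (hv : E.V < v) :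
    H s v = 0 := by
  induction hH with
  | base hh => simp [hh.2 v hv]
  | add _ _ h1 h2 => simp [h1, h2]
  | smul _ h => simp [h]

theorem Symbol.differentiable {H : ℂ → ℝ → ℂ} (hH : E.Symbol H) (v : ℝ) :
    Differentiable ℂ fun s => H s v := by
  induction hH with
  | base hh => fun_prop
  | add _ _ h1 h2 => exact h1.add h2
  | smul _ h => exact differentiable_id.mul h

/-- Symbols are closed under differentiation in `v`; the derivative of the exponential brings down
a factor `s`. -/
theorem Symbol.exists_deriv {H : ℂ → ℝ → ℂ} (hH : E.Symbol H) :
    ∃ H', E.Symbol H' ∧ ∀ s v, -(1 / 2) < v → HasDerivAt (H s) (H' s v) v := by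
  induction hH with
  | @base h hh =>
    have hμ : ContDiffOn ℝ ∞ (fun v => ((_root_.deriv E.logR v : ℝ) : ℂ))
        (Ioo (-(1 / 2)) (1 / E.a)) :=
      Complex.ofRealCLM.contDiff.comp_contDiffOn
        (E.contDiffOn_logR.deriv_of_isOpen isOpen_Ioo (by norm_num))
    refine ⟨_, (Symbol.base hh.deriv).add
      ((Symbol.base (hh.mul hμ)).mul (contDiffOn_const (c := (-1 : ℂ)))).smul, fun s v hv => ?_⟩
    by_cases hva : v < 1 / E.a
    · have hl : HasDerivAt E.logR (_root_.deriv E.logR v) v :=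
        ((E.contDiffOn_logR.contDiffAt (isOpen_Ioo.mem_nhds ⟨hv, hva⟩)).differentiableAt
          (by simp)).hasDerivAt
      have h1 := ((hl.ofReal_comp.const_mul (-s)).cexp).mul (hh.hasDerivAt hv)
      refine h1.congr_deriv ?_
      ring
    · have hv' : E.V < v := E.V_lt.trans_le (not_lt.1 hva)
      have h0 : (fun w => Complex.exp (-s * E.logR w) * h w) =ᶠ[𝓝 v] fun _ => 0 := by
        filter_upwards [isOpen_Ioi.mem_nhds (show v ∈ Ioi E.V from hv')] with w hw
        rw [hh.2 w hw, mul_zero]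
      refine ((hasDerivAt_const v (0 : ℂ)).congr_of_eventuallyEq h0).congr_deriv ?_
      rw [hh.deriv.2 v hv', hh.2 v hv']
      simp
  | add _ _ h1 h2 =>
    obtain ⟨D1, hD1, h1⟩ := h1
    obtain ⟨D2, hD2, h2⟩ := h2
    exact ⟨_, hD1.add hD2, fun s v hv => (h1 s v hv).add (h2 s v hv)⟩
  | smul _ h =>
    obtain ⟨D, hD, h⟩ := h
    exact ⟨_, hD.smul, fun s v hv => (h s v hv).const_mul s⟩

theorem Symbol.exists_bound {H : ℂ → ℝ → ℂ} (hH : E.Symbol H) (S : ℝ) :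
    ∃ C : ℝ, 0 ≤ C ∧ ∀ s : ℂ, ‖s‖ ≤ S → ∀ v : ℝ, 0 ≤ v → ‖H s v‖ ≤ C := by
  induction hH with
  | @base h hh =>
    have hsub : Icc 0 E.V ⊆ Ioo (-(1 / 2)) (1 / E.a) := fun v hv =>
      ⟨by linarith [hv.1], hv.2.trans_lt E.V_lt⟩
    obtain ⟨A, hA⟩ := (isCompact_Icc (a := (0 : ℝ)) (b := E.V)).exists_bound_of_continuousOn
      (E.contDiffOn_logR.continuousOn.mono hsub)
    obtain ⟨B, hB⟩ := (isCompact_Icc (a := (0 : ℝ)) (b := E.V)).exists_bound_of_continuousOn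
      (hh.1.continuousOn.mono fun v hv => (hsub hv).1)
    have h0 : (0 : ℝ) ∈ Icc 0 E.V := ⟨le_rfl, E.V_pos.le⟩
    have hB0 : 0 ≤ B := (norm_nonneg _).trans (hB 0 h0)
    refine ⟨Real.exp (S * A) * B, by positivity, fun s hs v hv => ?_⟩
    by_cases hvV : v ≤ E.V
    · rw [norm_mul]
      refine mul_le_mul ?_ (hB v ⟨hv, hvV⟩) (norm_nonneg _) (Real.exp_nonneg _)
      rw [Complex.norm_exp]
      refine Real.exp_le_exp.2 ((Complex.re_le_norm _).trans ?_)
      rw [norm_mul, norm_neg, Complex.norm_real]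
      exact mul_le_mul hs (hA v ⟨hv, hvV⟩) (norm_nonneg _) ((norm_nonneg _).trans hs)
    · simp only [hh.2 v (not_le.1 hvV), mul_zero, norm_zero]
      positivity
  | add _ _ h1 h2 =>
    obtain ⟨C1, hC1, h1⟩ := h1
    obtain ⟨C2, hC2, h2⟩ := h2
    exact ⟨C1 + C2, by positivity, fun s hs v hv =>
      (norm_add_le _ _).trans (add_le_add (h1 s hs v hv) (h2 s hs v hv))⟩
  | smul _ h =>
    obtain ⟨C, hC, h⟩ := h
    refine ⟨|S| * C, by positivity, fun s hs v hv => ?_⟩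
    rw [norm_mul]
    exact mul_le_mul (hs.trans (le_abs_self S)) (h s hs v hv) (norm_nonneg _) (abs_nonneg _)

/-- If `H` is the symbol of `u ^ (-(d s + k)) * H s u⁻¹`, then `H'` is the symbol of its derivative
in `u`, relative to the power `u ^ (-(d s + k + 1))`. -/
theorem Symbol.exists_next {H : ℂ → ℝ → ℂ} (hH : E.Symbol H) (k : ℕ) :
    ∃ H', E.Symbol H' ∧ ∀ s v, -(1 / 2) < v →
      ∃ D, HasDerivAt (H s) D v ∧ H' s v = -(E.d * s + k) * H s v - v * D := by
  obtain ⟨D, hD, h⟩ := hH.exists_deriv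
  have hv : ContDiffOn ℝ ∞ (fun v : ℝ => -(v : ℂ)) (Ioo (-(1 / 2)) (1 / E.a)) :=
    (Complex.ofRealCLM.contDiff.neg).contDiffOn
  refine ⟨_, ((hH.mul (contDiffOn_const (c := -(E.d : ℂ)))).smul.add
    (hH.mul (contDiffOn_const (c := -(k : ℂ))))).add (hD.mul hv), fun s v hv => ⟨_, h s v hv, ?_⟩⟩
  ring

variable (E) in
/-- The symbols of the successive derivatives of the summand along the edge. -/
theorem exists_symbols : ∃ H : ℕ → ℂ → ℝ → ℂ,
    (H 0 = fun s v => Complex.exp (-s * E.logR v) * (E.cutoff v : ℂ)) ∧ (∀ k, E.Symbol (H k)) ∧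
    ∀ k s v, -(1 / 2) < v →
      ∃ D, HasDerivAt (H k s) D v ∧ H (k + 1) s v = -(E.d * s + k) * H k s v - v * D := by
  choose f hf hf' using fun (k : ℕ) (H : {H // E.Symbol H}) => H.2.exists_next k
  let G : ℕ → {H // E.Symbol H} := fun k => Nat.rec
    ⟨_, Symbol.base E.isBump_cutoff⟩ (fun k H => ⟨f k H, hf k H⟩) k
  exact ⟨fun k => (G k).1, rfl, fun k => (G k).2, fun k s v hv => hf' k (G k) s v hv⟩

variable (E)

/-- A choice of symbols of the successive derivatives of the summand along the edge. -/
noncomputable def symb : ℕ → ℂ → ℝ → ℂ := E.exists_symbols.choose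

theorem symb_zero : E.symb 0 = fun s v => Complex.exp (-s * E.logR v) * (E.cutoff v : ℂ) :=
  E.exists_symbols.choose_spec.1

theorem symbol_symb (k : ℕ) : E.Symbol (E.symb k) := E.exists_symbols.choose_spec.2.1 k

/-- The `k`-th derivative, in `x = m / n`, of the normalised summand along the edge. -/
noncomputable def F (k : ℕ) (s : ℂ) (x : ℝ) : ℂ :=
  Complex.exp (-(E.d * s + k) * Real.log (x + E.a)) * E.symb k s (1 / (x + E.a))

theorem hasDerivAt_F (k : ℕ) (s : ℂ) {x : ℝ} (hx : 0 ≤ x) :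
    HasDerivAt (E.F k s) (E.F (k + 1) s x) x := by
  have hu : 0 < x + E.a := by linarith [E.a_pos]
  have hv : -(1 / 2) < 1 / (x + E.a) := by
    have : 0 < 1 / (x + E.a) := by positivity
    linarith
  obtain ⟨D, hD, hD'⟩ := E.exists_symbols.choose_spec.2.2 k s _ hv
  have h1 : HasDerivAt (fun x : ℝ => x + E.a) 1 x := (hasDerivAt_id x).add_const _
  have h2 : HasDerivAt (fun x : ℝ => 1 / (x + E.a)) (-1 / (x + E.a) ^ 2) x := by
    simpa using h1.fun_inv hu.ne'
  have h3 := ((h1.log hu.ne').ofReal_comp.const_mul (-(E.d * s + k))).cexp.mul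
    (hD.scomp x h2)
  refine h3.congr_deriv ?_
  have hne : ((x : ℂ) + E.a) ≠ 0 := by exact_mod_cast hu.ne'
  have hexp : Complex.exp (-(E.d * s + (k + 1 : ℕ)) * Real.log (x + E.a)) =
      Complex.exp (-(E.d * s + k) * Real.log (x + E.a)) * (1 / (x + E.a)) := by
    have : -(E.d * s + (k + 1 : ℕ)) * (Real.log (x + E.a) : ℂ) =
        -(E.d * s + k) * Real.log (x + E.a) - Real.log (x + E.a) := by push_cast; ring
    rw [this, Complex.exp_sub, Complex.ofReal_log hu.le,
      Complex.exp_log (by exact_mod_cast hu.ne')]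
    push_cast
    ring
  rw [F, hexp]
  change _ = _ * E.exists_symbols.choose (k + 1) s (1 / (x + E.a))
  rw [hD']
  simp only [Function.comp_apply, Complex.real_smul]
  push_cast
  field_simp
  ring

theorem F_eq_zero (k : ℕ) (s : ℂ) {x : ℝ} (hx0 : 0 ≤ x) (hx : x < 1 / 2) : E.F k s x = 0 := by
  have ha := E.a_pos
  rw [F, (E.symbol_symb k).eq_zero s, mul_zero]
  exact one_div_lt_one_div_of_lt (by linarith) (by linarith)

theorem differentiable_F (k : ℕ) (x : ℝ) : Differentiable ℂ fun s => E.F k s x := by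
  have := (E.symbol_symb k).differentiable (1 / (x + E.a))
  unfold F
  fun_prop

theorem continuousOn_F (k : ℕ) (s : ℂ) : ContinuousOn (E.F k s) (Ici 0) := fun _ hx =>
  (E.hasDerivAt_F k s hx).continuousAt.continuousWithinAt

/-- The `k`-th derivative decays by `k` powers more than the function itself, locally uniformly
in `s`. -/
theorem exists_bound_F (k : ℕ) (S σ : ℝ) : ∃ C : ℝ, 0 ≤ C ∧ ∀ s : ℂ, ‖s‖ ≤ S → σ ≤ s.re →
    ∀ x : ℝ, 0 ≤ x → ‖E.F k s x‖ ≤ C * (x + E.a) ^ (-(E.d * σ + k)) := by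
  obtain ⟨C, hC0, hC⟩ := (E.symbol_symb k).exists_bound S
  refine ⟨C, hC0, fun s hs hσ x hx => ?_⟩
  have ha := E.a_pos
  have hu : 0 < x + E.a := by linarith
  by_cases hx2 : x < 1 / 2
  · rw [E.F_eq_zero k s hx hx2, norm_zero]; positivity
  -- On the support `u ≥ 1`, so that powers of `u` are monotone in the exponent.
  · have hu1 : 1 ≤ x + E.a := by linarith [E.half_le_a]
    rw [F, norm_mul, mul_comm]
    refine mul_le_mul (hC s hs _ (by positivity)) ?_ (norm_nonneg _) hC0
    rw [Complex.norm_exp, Real.rpow_def_of_pos hu]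
    refine Real.exp_le_exp.2 ?_
    have hre : (-(E.d * s + k) * (Real.log (x + E.a) : ℂ)).re =
        -(E.d * s.re + k) * Real.log (x + E.a) := by
      rw [Complex.re_mul_ofReal]
      simp
    rw [hre, mul_comm (Real.log _)]
    refine mul_le_mul_of_nonneg_right ?_ (Real.log_nonneg hu1)
    have := mul_le_mul_of_nonneg_left hσ (Nat.cast_nonneg (α := ℝ) E.d)
    linarith

theorem integrableOn_rpow {p : ℝ} (hp : 1 < p) :
    IntegrableOn (fun x : ℝ => (x + E.a) ^ (-p)) (Ioi 0) :=
  integrableOn_add_rpow_Ioi_of_lt (by linarith) (by linarith [E.a_pos])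

theorem integrableOn_F (k : ℕ) {s : ℂ} (hs : 1 < E.d * s.re + k) :
    IntegrableOn (E.F k s) (Ioi 0) := by
  obtain ⟨C, -, hC⟩ := E.exists_bound_F k ‖s‖ s.re
  refine Integrable.mono' ((E.integrableOn_rpow hs).const_mul C) ?_ ?_
  · exact ((E.continuousOn_F k s).mono Ioi_subset_Ici_self).aestronglyMeasurable measurableSet_Ioi
  · filter_upwards [ae_restrict_mem measurableSet_Ioi] with x hx
    exact hC s le_rfl le_rfl x (le_of_lt hx)

end EdgeData

namespace EdgeData

variable (E : EdgeData)

/-! ### The sum over the cone around an edge -/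

/-- The integral of the normalised summand across the cone. -/
noncomputable def J (s : ℂ) : ℂ := ∫ x in Ioi (0 : ℝ), E.F 0 s x

/-- The Euler–Maclaurin remainder of the inner sum, up to a power of `n`. -/
noncomputable def innerRem (k n : ℕ) (s : ℂ) : ℂ :=
  ∫ x in Ioi (0 : ℝ), ((bernoulliFun k (Int.fract (n * x)) : ℝ) : ℂ) * E.F k s x

/-- Euler–Maclaurin summation for the inner sum, at a fixed value of `n`. -/
theorem tsum_F_eq {s : ℂ} (hs : 1 < E.d * s.re) {n : ℕ} (hn : 0 < n)
    (hsum : Summable fun m : ℕ => E.F 0 s ((m + 1 : ℕ) / n)) (K : ℕ) :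
    ∑' m : ℕ, E.F 0 s ((m + 1 : ℕ) / n) = n * E.J s +
      (-1) ^ K / (K + 1).factorial * (((n : ℂ) ^ K)⁻¹ * E.innerRem (K + 1) n s) := by
  have hn' : (0 : ℝ) < n := by exact_mod_cast hn
  have hnc : (n : ℂ) ≠ 0 := by exact_mod_cast hn.ne'
  set g : ℕ → ℝ → ℂ := fun k t => ((n : ℂ) ^ k)⁻¹ * E.F k s (t / n) with hg
  have h1 := tsum_eq_integral_add_bernoulli (g := g) (fun k t ht => by
      have h2 : HasDerivAt (fun t : ℝ => t / n) (1 / n) t := (hasDerivAt_id t).div_const _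
      refine (((E.hasDerivAt_F k s (div_nonneg ht hn'.le)).scomp t h2).const_mul _).congr_deriv ?_
      simp only [hg, Complex.real_smul]
      push_cast
      field_simp
      ring)
    (fun k => by simp only [hg]; rw [zero_div, E.F_eq_zero k s le_rfl (by norm_num), mul_zero])
    (fun k => by
      refine Integrable.const_mul ?_ _
      have h2 := E.integrableOn_F k (s := s)
        (by have : (0 : ℝ) ≤ k := Nat.cast_nonneg k
            linarith)
      have := (integrableOn_Ioi_comp_mul_right_iff (E.F k s) 0 (inv_pos.2 hn')).2 (by simpa using h2)
      simpa only [div_eq_mul_inv, IntegrableOn] using this)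
    (by simpa [hg] using hsum) K
  have hsub : ∀ f : ℝ → ℂ, ∫ t in Ioi (0 : ℝ), f t = n * ∫ x in Ioi (0 : ℝ), f (n * x) := by
    intro f
    rw [integral_comp_mul_left_Ioi f 0 hn', mul_zero, Complex.real_smul]
    push_cast
    field_simp
  have e0 : ∀ m : ℕ, g 0 (m + 1 : ℕ) = E.F 0 s ((m + 1 : ℕ) / n) := fun m => by simp [hg]
  rw [tsum_congr e0] at h1
  rw [h1, hsub (g 0), hsub (fun t => ((bernoulliFun (K + 1) (Int.fract t) : ℝ) : ℂ) * g (K + 1) t)]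
  have e1 : ∀ x : ℝ, (n * x) / n = x := fun x => by field_simp
  simp only [hg, e1]
  have e2 : ∀ x : ℝ, ((bernoulliFun (K + 1) (Int.fract (n * x)) : ℝ) : ℂ) *
      (((n : ℂ) ^ (K + 1))⁻¹ * E.F (K + 1) s x) = ((n : ℂ) ^ (K + 1))⁻¹ *
      (((bernoulliFun (K + 1) (Int.fract (n * x)) : ℝ) : ℂ) * E.F (K + 1) s x) := fun x => by ring
  simp only [e2, integral_const_mul, pow_zero, inv_one, one_mul]
  rw [J, innerRem, pow_succ]
  field_simp

/-- The term of the series over the cone, indexed so that `p = (n - 1, m - 1)`; the variable `n`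
that is small compared to `m` comes first. -/
noncomputable def term (s : ℂ) (p : ℕ × ℕ) : ℂ :=
  Complex.exp (-((E.d + 1) * s) * Real.log (p.1 + 1 : ℕ)) *
    E.F 0 s ((p.2 + 1 : ℕ) / (p.1 + 1 : ℕ))

/-- The Euler–Maclaurin remainder of the sum over the cone, up to a constant. -/
noncomputable def rem (K : ℕ) (s : ℂ) : ℂ :=
  ∑' n : ℕ, Complex.exp (-((E.d + 1) * s + K) * Real.log (n + 1 : ℕ)) *
    E.innerRem (K + 1) (n + 1) s

theorem exists_bound_innerRem (k : ℕ) (S : ℝ) {σ : ℝ} (hσ : 1 < E.d * σ + k) :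
    ∃ C : ℝ, 0 ≤ C ∧ ∀ s : ℂ, ‖s‖ ≤ S → σ ≤ s.re → ∀ n : ℕ, ‖E.innerRem k n s‖ ≤ C := by
  obtain ⟨B, hB0, hB⟩ := exists_bound_bernoulliFun_fract k
  obtain ⟨C, hC0, hC⟩ := E.exists_bound_F k S σ
  refine ⟨∫ x in Ioi (0 : ℝ), B * (C * (x + E.a) ^ (-(E.d * σ + k))), ?_, fun s hs hsσ n => ?_⟩
  · refine setIntegral_nonneg measurableSet_Ioi fun x hx => ?_
    have : 0 < x + E.a := by linarith [E.a_pos, mem_Ioi.1 hx]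
    positivity
  · refine norm_integral_le_of_norm_le (((E.integrableOn_rpow hσ).const_mul C).const_mul B) ?_
    filter_upwards [ae_restrict_mem measurableSet_Ioi] with x hx
    rw [norm_mul]
    exact mul_le_mul (hB _) (hC s hs hsσ x (le_of_lt hx)) (norm_nonneg _) hB0

theorem differentiableOn_innerRem (k n : ℕ) (S : ℝ) {σ : ℝ} (hσ : 1 < E.d * σ + k) :
    DifferentiableOn ℂ (E.innerRem k n) ({s | σ < s.re} ∩ Metric.ball 0 S) := by
  obtain ⟨B, hB0, hB⟩ := exists_bound_bernoulliFun_fract k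
  obtain ⟨C, hC0, hC⟩ := E.exists_bound_F k S σ
  refine differentiableOn_integral_of_dominated
    ((isOpen_lt continuous_const Complex.continuous_re).inter Metric.isOpen_ball)
    (fun s _ => ?_) (Eventually.of_forall fun x => ?_)
    (((E.integrableOn_rpow hσ).const_mul C).const_mul B) ?_
  · refine AEStronglyMeasurable.mul ?_ ?_
    · exact ((measurable_bernoulliFun_fract k).comp
        (measurable_const_mul (n : ℝ))).aestronglyMeasurable
    · exact ((E.continuousOn_F k s).mono Ioi_subset_Ici_self).aestronglyMeasurable
        measurableSet_Ioi
  · exact ((E.differentiable_F k x).const_mul _).differentiableOn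
  · filter_upwards [ae_restrict_mem measurableSet_Ioi] with x hx s hs
    rw [norm_mul]
    exact mul_le_mul (hB _)
      (hC s (mem_ball_zero_iff.1 hs.2).le (le_of_lt hs.1) x (le_of_lt hx)) (norm_nonneg _) hB0

theorem norm_exp_mul_log (z : ℂ) (n : ℕ) :
    ‖Complex.exp (-z * Real.log (n + 1 : ℕ))‖ = ((n + 1 : ℕ) : ℝ) ^ (-z.re) := by
  rw [Complex.norm_exp, Complex.re_mul_ofReal, Complex.neg_re,
    Real.rpow_def_of_pos (by positivity), mul_comm]

/-- The bound under which the series `rem` is summed. -/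
theorem exists_bound_rem (K : ℕ) (S : ℝ) {σ : ℝ} (hσ0 : σ ≤ 0) (hσ : 1 < (E.d + 1) * σ + K) :
    ∃ C : ℝ, ∀ s : ℂ, ‖s‖ ≤ S → σ ≤ s.re → ∀ n : ℕ,
      ‖Complex.exp (-((E.d + 1) * s + K) * Real.log (n + 1 : ℕ)) * E.innerRem (K + 1) (n + 1) s‖ ≤
        ((n + 1 : ℕ) : ℝ) ^ (-((E.d + 1) * σ + K)) * C := by
  obtain ⟨C, hC0, hC⟩ := E.exists_bound_innerRem (K + 1) S (σ := σ)
    (by push_cast; nlinarith)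
  refine ⟨C, fun s hs hsσ n => ?_⟩
  rw [norm_mul, norm_exp_mul_log]
  refine mul_le_mul ?_ (hC s hs hsσ _) (norm_nonneg _) (by positivity)
  refine Real.rpow_le_rpow_of_exponent_le (by push_cast; linarith [Nat.cast_nonneg (α := ℝ) n]) ?_
  have : (((E.d : ℂ) + 1) * s + K).re = (E.d + 1) * s.re + K := by simp [Complex.add_re]
  rw [this]
  have := mul_le_mul_of_nonneg_left hsσ (by positivity : (0 : ℝ) ≤ E.d + 1)
  linarith

theorem summable_rpow_succ {p : ℝ} (hp : 1 < p) :
    Summable fun n : ℕ => ((n + 1 : ℕ) : ℝ) ^ (-p) :=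
  (summable_nat_add_iff 1).2 (Real.summable_nat_rpow.2 (by linarith))

theorem differentiableOn_rem (K : ℕ) {σ : ℝ} (hσ0 : σ ≤ 0) (hσ : 1 < (E.d + 1) * σ + K) :
    DifferentiableOn ℂ (E.rem K) {s | σ < s.re} := by
  intro s hs
  have hopen : IsOpen ({s : ℂ | σ < s.re} ∩ Metric.ball 0 (‖s‖ + 1)) :=
    (isOpen_lt continuous_const Complex.continuous_re).inter Metric.isOpen_ball
  obtain ⟨C, hC⟩ := E.exists_bound_rem K (‖s‖ + 1) hσ0 hσ
  have hd : DifferentiableOn ℂ (E.rem K) ({s | σ < s.re} ∩ Metric.ball 0 (‖s‖ + 1)) := by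
    refine Complex.differentiableOn_tsum_of_summable_norm ((summable_rpow_succ hσ).mul_right C)
      (fun n => ?_) hopen
      fun n w hw => hC w (mem_ball_zero_iff.1 hw.2).le (le_of_lt hw.1) n
    refine DifferentiableOn.mul (by fun_prop) ?_
    exact E.differentiableOn_innerRem _ _ _ (by push_cast; nlinarith)
  exact (hd.differentiableAt (hopen.mem_nhds ⟨hs, by simp⟩)).differentiableWithinAt

/-- The sum over the cone: the homogeneous part `ζ ((d + 1) s - 1) * J s`, and a remainder that
is holomorphic in a half-plane growing with `K`. -/
theorem tsum_term_eq {s : ℂ} (hs : 1 < E.d * s.re) (hs2 : 2 < (E.d + 1) * s.re)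
    (hsum : Summable (E.term s)) (K : ℕ) :
    ∑' p, E.term s p = riemannZeta ((E.d + 1) * s - 1) * E.J s +
      (-1) ^ K / (K + 1).factorial * E.rem K s := by
  have hre : (((E.d : ℂ) + 1) * s).re = (E.d + 1) * s.re := by simp
  have hinner : ∀ n : ℕ, ∑' m : ℕ, E.term s (n, m) =
      1 / ((n : ℂ) + 1) ^ ((E.d + 1) * s - 1) * E.J s + (-1) ^ K / (K + 1).factorial *
        (Complex.exp (-((E.d + 1) * s + K) * Real.log (n + 1 : ℕ)) *
          E.innerRem (K + 1) (n + 1) s) := by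
    intro n
    have hn : ((n + 1 : ℕ) : ℂ) ≠ 0 := Nat.cast_ne_zero.2 (Nat.succ_ne_zero n)
    have hne := Complex.exp_ne_zero (-((E.d + 1) * s) * Real.log (n + 1 : ℕ))
    have hlog : Complex.exp (Real.log (n + 1 : ℕ)) = (n + 1 : ℕ) := by
      rw [Complex.ofReal_log (by positivity), Complex.exp_log (by exact_mod_cast hn)]
      push_cast; ring
    have hS : Summable fun m : ℕ => E.F 0 s ((m + 1 : ℕ) / (n + 1 : ℕ)) := by
      have h1 := hsum.prod_factor n
      simp only [term] at h1
      exact (summable_mul_left_iff hne).1 h1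
    simp only [term]
    rw [tsum_mul_left, E.tsum_F_eq hs (Nat.succ_pos n) hS K]
    have e1 : 1 / ((n : ℂ) + 1) ^ ((E.d + 1) * s - 1) =
        Complex.exp (-((E.d + 1) * s) * Real.log (n + 1 : ℕ)) * (n + 1 : ℕ) := by
      have : (n : ℂ) + 1 = (n + 1 : ℕ) := by push_cast; ring
      rw [this, Complex.cpow_def_of_ne_zero hn, one_div, ← Complex.exp_neg]
      nth_rewrite 2 [← hlog]
      rw [← Complex.exp_add, Complex.ofReal_log (by positivity)]
      congr 1
      push_cast; ring
    have e2 : Complex.exp (-((E.d + 1) * s + K) * Real.log (n + 1 : ℕ)) =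
        Complex.exp (-((E.d + 1) * s) * Real.log (n + 1 : ℕ)) * (((n + 1 : ℕ) : ℂ) ^ K)⁻¹ := by
      nth_rewrite 1 [← hlog]
      rw [← Complex.exp_nat_mul, ← Complex.exp_neg, ← Complex.exp_add]
      congr 1
      ring
    rw [e1, e2]
    ring
  rw [hsum.tsum_prod]
  simp only [hinner]
  have hz : 1 < (((E.d : ℂ) + 1) * s - 1).re := by
    rw [Complex.sub_re, hre, Complex.one_re]; linarith
  have hzs : Summable fun n : ℕ => 1 / ((n : ℂ) + 1) ^ (((E.d : ℂ) + 1) * s - 1) := by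
    have := (summable_nat_add_iff 1).2 (Complex.summable_one_div_nat_cpow.2 hz)
    simpa using this
  have hrs : Summable fun n : ℕ =>
      Complex.exp (-((E.d + 1) * s + K) * Real.log (n + 1 : ℕ)) * E.innerRem (K + 1) (n + 1) s := by
    obtain ⟨C, -, hC⟩ := E.exists_bound_innerRem (K + 1) ‖s‖ (σ := s.re)
      (by push_cast; linarith [Nat.cast_nonneg (α := ℝ) K])
    refine Summable.of_norm_bounded (g := fun n : ℕ =>
      ((n + 1 : ℕ) : ℝ) ^ (-((((E.d : ℂ) + 1) * s + K).re)) * C)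
      ((summable_rpow_succ ?_).mul_right C) fun n => ?_
    · rw [Complex.add_re, hre, Complex.natCast_re]
      linarith [Nat.cast_nonneg (α := ℝ) K]
    · rw [norm_mul, norm_exp_mul_log]
      exact mul_le_mul_of_nonneg_left (hC s le_rfl le_rfl _) (by positivity)
  rw [(hzs.mul_right _).tsum_add (hrs.mul_left _), tsum_mul_right, tsum_mul_left,
    zeta_eq_tsum_one_div_nat_add_one_cpow hz]
  rfl

end EdgeData

/-! ### Binomial series -/

/-- The coefficient `s (s + 1) ⋯ (s + j - 1) / j!` of `x ^ j` in `(1 - x) ^ (-s)`. -/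
noncomputable def negBinom (s : ℂ) (j : ℕ) : ℂ := (ascPochhammer ℂ j).eval s / j.factorial

theorem negBinom_zero (s : ℂ) : negBinom s 0 = 1 := by simp [negBinom]

theorem negBinom_succ (s : ℂ) (j : ℕ) :
    negBinom s (j + 1) = negBinom s j * ((s + j) / (j + 1)) := by
  rw [negBinom, negBinom, ascPochhammer_succ_eval, Nat.factorial_succ]
  push_cast
  rw [div_mul_div_comm, mul_comm ((j : ℂ) + 1)]

theorem differentiable_negBinom (j : ℕ) : Differentiable ℂ fun s => negBinom s j :=
  (Polynomial.differentiable _).div_const _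

theorem negBinom_neg_natCast {A j : ℕ} (h : A < j) : negBinom (-(A : ℂ)) j = 0 := by
  rw [negBinom, ascPochhammer_eval_neg_coe_nat_of_lt h, zero_div]

theorem negBinom_ne_zero {s : ℂ} {j : ℕ} (h : ∀ l : ℕ, l < j → s ≠ -(l : ℂ)) :
    negBinom s j ≠ 0 := by
  induction j with
  | zero => simp [negBinom_zero]
  | succ j ih =>
    rw [negBinom_succ]
    refine mul_ne_zero (ih fun l hl => h l (hl.trans (Nat.lt_succ_self j))) (div_ne_zero ?_ ?_)
    · intro h0
      exact h j (Nat.lt_succ_self j) (by linear_combination h0)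
    · exact Nat.cast_add_one_ne_zero j

theorem negBinom_eq_choose (s : ℂ) (j : ℕ) : negBinom s j = Ring.choose (s + j - 1) j := by
  rw [← Ring.multichoose_eq, negBinom, div_eq_iff (Nat.cast_ne_zero.2 (Nat.factorial_ne_zero _)),
    ← Polynomial.ascPochhammer_smeval_eq_eval, ← Ring.factorial_nsmul_multichoose_eq_ascPochhammer,
    nsmul_eq_mul, mul_comm]

theorem hasSum_negBinom (s : ℂ) {x : ℝ} (hx : |x| < 1) :
    HasSum (fun j => negBinom s j * (x : ℂ) ^ j) (Complex.exp (-s * Real.log (1 - x))) := by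
  have h1 : (x : ℂ) ∈ Metric.eball (0 : ℂ) 1 := by
    rw [Metric.mem_eball, edist_zero_right, ← ENNReal.coe_one, ← ofReal_norm,
      Complex.norm_real]
    simpa using hx
  have h2 := (Complex.one_div_one_sub_cpow_hasFPowerSeriesOnBall_zero s).hasSum h1
  have hx1 : 0 < 1 - x := by linarith [(abs_lt.1 hx).2]
  have e : 1 / (1 - (0 + (x : ℂ))) ^ s = Complex.exp (-s * Real.log (1 - x)) := by
    have : (1 - (0 + (x : ℂ))) = ((1 - x : ℝ) : ℂ) := by push_cast; ring
    rw [this, Complex.cpow_def_of_ne_zero (by exact_mod_cast hx1.ne'), one_div, ← Complex.exp_neg,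
      Complex.ofReal_log hx1.le]
    congr 1
    ring
  rw [e] at h2
  refine h2.congr_fun fun j => ?_
  rw [FormalMultilinearSeries.ofScalars_apply_eq, negBinom_eq_choose, smul_eq_mul]

/-- The majorant of `negBinom s` for `‖s‖ ≤ S`. -/
theorem norm_negBinom_le {s : ℂ} {S : ℝ} (hs : ‖s‖ ≤ S) (j : ℕ) :
    ‖negBinom s j‖ ≤ ‖negBinom (S : ℂ) j‖ := by
  have hS : 0 ≤ S := (norm_nonneg _).trans hs
  induction j with
  | zero => simp [negBinom_zero]
  | succ j ih =>
    rw [negBinom_succ, negBinom_succ, norm_mul, norm_mul]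
    refine mul_le_mul ih ?_ (norm_nonneg _) (norm_nonneg _)
    rw [norm_div, norm_div]
    refine div_le_div_of_nonneg_right ?_ (norm_nonneg _)
    have e : ‖(S : ℂ) + j‖ = S + j := by
      have : (S : ℂ) + j = ((S + j : ℝ) : ℂ) := by push_cast; ring
      rw [this, Complex.norm_of_nonneg (by positivity)]
    rw [e]
    refine (norm_add_le _ _).trans ?_
    simpa using hs

theorem summable_norm_negBinom (S : ℝ) {x : ℝ} (hx : |x| < 1) :
    Summable fun j => ‖negBinom (S : ℂ) j * (x : ℂ) ^ j‖ :=
  (hasSum_negBinom S hx).summable.norm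

namespace EdgeData

variable (E : EdgeData)

/-! ### The integral across the cone -/

/-- The coefficient of `w ^ i` in `r w ^ (-s)`. -/
noncomputable def coef (i : ℕ) (s : ℂ) : ℂ :=
  Complex.exp (-s * Real.log E.C) * ∑ p ∈ Finset.HasAntidiagonal.antidiagonal i,
    (negBinom s p.1 * (E.b₁ : ℂ) ^ p.1) * (negBinom s p.2 * (E.b₂ : ℂ) ^ p.2)

/-- The value of `u` at `m / n = 2`; the cutoff is `1` for larger `u`. -/
noncomputable def U : ℝ := 2 + E.a

theorem U_pos : 0 < E.U := by have := E.a_pos; unfold U; linarith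

theorem one_le_U : 1 ≤ E.U := by have := E.a_pos; unfold U; linarith

theorem abs_mul_lt_one {b w : ℝ} (hb0 : 0 ≤ b) (hb : b ≤ E.a ^ 2) (hw0 : 0 ≤ w)
    (hw : w ≤ (E.U ^ 2)⁻¹) : |b * w| < 1 := by
  have ha := E.a_pos
  have hU : 0 < E.U ^ 2 := pow_pos E.U_pos 2
  rw [abs_of_nonneg (by positivity)]
  calc b * w ≤ E.a ^ 2 * (E.U ^ 2)⁻¹ := by gcongr
    _ < 1 := by
      rw [← div_eq_mul_inv, div_lt_one hU]
      unfold U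
      nlinarith

theorem differentiable_coef (i : ℕ) : Differentiable ℂ (E.coef i) := by
  have := differentiable_negBinom
  unfold coef
  refine Differentiable.mul (by fun_prop) ?_
  refine Differentiable.fun_sum fun p _ => ?_
  exact ((this p.1).mul_const _).mul ((this p.2).mul_const _)

theorem sum_antidiagonal_mul_pow (i : ℕ) (f g : ℕ → ℂ) (b c w : ℂ) :
    (∑ p ∈ Finset.HasAntidiagonal.antidiagonal i, (f p.1 * b ^ p.1) * (g p.2 * c ^ p.2)) * w ^ i =
      ∑ p ∈ Finset.HasAntidiagonal.antidiagonal i, (f p.1 * (b * w) ^ p.1) * (g p.2 * (c * w) ^ p.2) := by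
  rw [Finset.sum_mul]
  refine Finset.sum_congr rfl fun p hp => ?_
  rw [← Finset.HasAntidiagonal.mem_antidiagonal.1 hp, pow_add, mul_pow, mul_pow]
  ring

/-- A summable majorant of the terms of the series of `r w ^ (-s)` at `w = U⁻²`. -/
theorem exists_majorant (S : ℝ) : ∃ M : ℕ → ℝ, Summable M ∧ ∀ i, ∀ s : ℂ, ‖s‖ ≤ S →
    ‖E.coef i s‖ * ((E.U ^ 2)⁻¹) ^ i ≤ M i := by
  set w : ℝ := (E.U ^ 2)⁻¹ with hw
  have hw0 : 0 ≤ w := by have := E.U_pos; positivity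
  have h1 := summable_norm_negBinom S (E.abs_mul_lt_one E.b₁_nonneg E.b₁_le hw0 le_rfl)
  have h2 := summable_norm_negBinom S (E.abs_mul_lt_one E.b₂_nonneg E.b₂_le hw0 le_rfl)
  have h3 := (summable_norm_sum_mul_antidiagonal_of_summable_norm h1.norm h2.norm).of_norm
  refine ⟨_, h3.mul_left (Real.exp (S * |Real.log E.C|)), fun i s hs => ?_⟩
  have hS : 0 ≤ S := (norm_nonneg _).trans hs
  have e : ‖E.coef i s‖ * w ^ i = ‖E.coef i s * (w : ℂ) ^ i‖ := by
    rw [norm_mul, norm_pow, Complex.norm_of_nonneg hw0]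
  rw [e, coef, mul_assoc, sum_antidiagonal_mul_pow, norm_mul]
  refine mul_le_mul ?_ ?_ (norm_nonneg _) (Real.exp_nonneg _)
  · rw [Complex.norm_exp]
    refine Real.exp_le_exp.2 ((Complex.re_le_norm _).trans ?_)
    rw [norm_mul, norm_neg, Complex.norm_real]
    exact mul_le_mul_of_nonneg_right hs (norm_nonneg _)
  · refine (norm_sum_le _ _).trans (Finset.sum_le_sum fun p _ => ?_)
    simp only [norm_mul, Complex.ofReal_mul]
    have := norm_negBinom_le hs p.1
    have := norm_negBinom_le hs p.2
    gcongr

theorem hasSum_coef (s : ℂ) {w : ℝ} (hw0 : 0 ≤ w) (hw : w ≤ (E.U ^ 2)⁻¹) :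
    HasSum (fun i => E.coef i s * (w : ℂ) ^ i)
      (Complex.exp (-s * Real.log (E.C * (1 - E.b₁ * w) * (1 - E.b₂ * w)))) := by
  have hb₁ := E.abs_mul_lt_one E.b₁_nonneg E.b₁_le hw0 hw
  have hb₂ := E.abs_mul_lt_one E.b₂_nonneg E.b₂_le hw0 hw
  have h1 := hasSum_negBinom s hb₁
  have h2 := hasSum_negBinom s hb₂
  have h3 := (summable_norm_sum_mul_antidiagonal_of_summable_norm h1.summable.norm
    h2.summable.norm).of_norm.hasSum
  rw [← tsum_mul_tsum_eq_tsum_sum_antidiagonal_of_summable_norm h1.summable.norm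
    h2.summable.norm, h1.tsum_eq, h2.tsum_eq] at h3
  have h4 := h3.mul_left (Complex.exp (-s * Real.log E.C))
  have p1 : 0 < 1 - E.b₁ * w := by linarith [(abs_lt.1 hb₁).2]
  have p2 : 0 < 1 - E.b₂ * w := by linarith [(abs_lt.1 hb₂).2]
  have e : Complex.exp (-s * Real.log (E.C * (1 - E.b₁ * w) * (1 - E.b₂ * w))) =
      Complex.exp (-s * Real.log E.C) * (Complex.exp (-s * Real.log (1 - E.b₁ * w)) *
        Complex.exp (-s * Real.log (1 - E.b₂ * w))) := by
    rw [Real.log_mul (mul_pos E.C_pos p1).ne' p2.ne', Real.log_mul E.C_pos.ne' p1.ne',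
      ← Complex.exp_add, ← Complex.exp_add]
    congr 1
    push_cast; ring
  rw [e]
  refine h4.congr_fun fun i => ?_
  rw [coef, mul_assoc, sum_antidiagonal_mul_pow]
  push_cast
  rfl

/-- The contribution to `J` of the `i`-th term of the expansion of the summand at infinity. -/
noncomputable def poleTerm (i : ℕ) (s : ℂ) : ℂ :=
  E.coef i s * Complex.exp (-(E.d * s + 2 * i - 1) * Real.log E.U) / (E.d * s + 2 * i - 1)

theorem integral_exp_neg_mul_log {w : ℂ} (hw : 1 < w.re) :
    ∫ x in Ioi (2 : ℝ), Complex.exp (-w * Real.log (x + E.a)) =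
      Complex.exp (-(w - 1) * Real.log E.U) / (w - 1) := by
  have ha := E.a_pos
  have hne : w - 1 ≠ 0 := by
    intro h
    have := congrArg Complex.re h
    simp at this
    linarith
  have hd : ∀ x ∈ Ici (2 : ℝ), HasDerivAt
      (fun x : ℝ => -(Complex.exp (-(w - 1) * Real.log (x + E.a)) / (w - 1)))
      (Complex.exp (-w * Real.log (x + E.a))) x := by
    intro x hx
    have hu : 0 < x + E.a := by linarith [mem_Ici.1 hx]
    have h1 : HasDerivAt (fun x : ℝ => x + E.a) 1 x := (hasDerivAt_id x).add_const _
    refine ((((h1.log hu.ne').ofReal_comp.const_mul (-(w - 1))).cexp.div_const (w - 1)).neg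
      ).congr_deriv ?_
    have hexp : Complex.exp (-w * Real.log (x + E.a)) =
        Complex.exp (-(w - 1) * Real.log (x + E.a)) * (1 / (x + E.a) : ℝ) := by
      have : -w * (Real.log (x + E.a) : ℂ) =
          -(w - 1) * Real.log (x + E.a) - Real.log (x + E.a) := by ring
      rw [this, Complex.exp_sub, Complex.ofReal_log hu.le,
        Complex.exp_log (by exact_mod_cast hu.ne')]
      push_cast
      ring
    rw [hexp]
    field_simp
  have hint : IntegrableOn (fun x : ℝ => Complex.exp (-w * Real.log (x + E.a))) (Ioi 2) := by
    refine Integrable.mono' ((E.integrableOn_rpow hw).mono_set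
      (Ioi_subset_Ioi (by norm_num : (0 : ℝ) ≤ 2))) ?_ ?_
    · refine ContinuousOn.aestronglyMeasurable (fun x hx => ?_) measurableSet_Ioi
      have hu : x + E.a ≠ 0 := by
        have := mem_Ioi.1 hx
        linarith
      exact (ContinuousAt.continuousWithinAt (by fun_prop (disch := assumption)))
    · filter_upwards [ae_restrict_mem measurableSet_Ioi] with x hx
      have hu : 0 < x + E.a := by linarith [mem_Ioi.1 hx]
      rw [Complex.norm_exp, Complex.re_mul_ofReal, Complex.neg_re, Real.rpow_def_of_pos hu,
        mul_comm]
  have ht : Tendsto (fun x : ℝ => -(Complex.exp (-(w - 1) * Real.log (x + E.a)) / (w - 1)))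
      atTop (𝓝 0) := by
    have h1 : Tendsto (fun x : ℝ => Complex.exp (-(w - 1) * Real.log (x + E.a))) atTop (𝓝 0) := by
      rw [tendsto_zero_iff_norm_tendsto_zero]
      simp only [Complex.norm_exp, Complex.re_mul_ofReal]
      refine Real.tendsto_exp_atBot.comp ?_
      have h2 : Tendsto (fun x : ℝ => Real.log (x + E.a)) atTop atTop :=
        Real.tendsto_log_atTop.comp (tendsto_atTop_add_const_right _ _ tendsto_id)
      exact h2.const_mul_atTop_of_neg (by simp; linarith)
    simpa using (h1.div_const (w - 1)).neg
  rw [integral_Ioi_of_hasDerivAt_of_tendsto' hd hint ht]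
  simp [U]

/-- Beyond the cutoff, the summand is given by its expansion at infinity. -/
theorem hasSum_F_zero (s : ℂ) {x : ℝ} (hx : 2 < x) :
    HasSum (fun i : ℕ => E.coef i s * Complex.exp (-(E.d * s + 2 * i) * Real.log (x + E.a)))
      (E.F 0 s x) := by
  have ha := E.a_pos
  have hu : 0 < x + E.a := by linarith
  have hw : (1 / (x + E.a)) ^ 2 ≤ (E.U ^ 2)⁻¹ := by
    rw [one_div, inv_pow]
    have : E.U ≤ x + E.a := by unfold U; linarith
    have := E.U_pos
    gcongr
  have h1 := (E.hasSum_coef s (by positivity) hw).mul_left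
    (Complex.exp (-(E.d * s) * Real.log (x + E.a)))
  have e : E.F 0 s x = Complex.exp (-(E.d * s) * Real.log (x + E.a)) *
      Complex.exp (-s * Real.log (E.C * (1 - E.b₁ * (1 / (x + E.a)) ^ 2) *
        (1 - E.b₂ * (1 / (x + E.a)) ^ 2))) := by
    rw [F, E.symb_zero]
    have : E.cutoff (1 / (x + E.a)) = 1 :=
      E.cutoff_eq_one (by positivity) (one_div_le_one_div_of_le (by linarith) (by linarith))
    simp only [this, logR]
    simp
  rw [e]
  refine h1.congr_fun fun i => ?_
  have : (((1 / (x + E.a)) ^ 2 : ℝ) : ℂ) ^ i =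
      Complex.exp (-(2 * i) * Real.log (x + E.a)) := by
    rw [← Complex.ofReal_pow, ← pow_mul, one_div, inv_pow, ← Real.exp_log (pow_pos hu (2 * i)),
      ← Real.exp_neg, Real.log_pow, Complex.ofReal_exp]
    congr 1
    push_cast; ring
  rw [this, mul_left_comm, ← Complex.exp_add]
  congr 2
  ring

theorem hasSum_poleTerm {s : ℂ} (hs : 1 < E.d * s.re) :
    HasSum (fun i => E.poleTerm i s) (∫ x in Ioi (2 : ℝ), E.F 0 s x) := by
  have ha := E.a_pos
  obtain ⟨M, hM, hMle⟩ := E.exists_majorant ‖s‖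
  have e : ∀ i : ℕ, E.poleTerm i s = ∫ x in Ioi (2 : ℝ),
      E.coef i s * Complex.exp (-(E.d * s + 2 * i) * Real.log (x + E.a)) := by
    intro i
    have hre : ((E.d : ℂ) * s + 2 * i).re = E.d * s.re + 2 * i := by simp
    rw [integral_const_mul, E.integral_exp_neg_mul_log (by
      rw [hre]; linarith [Nat.cast_nonneg (α := ℝ) i]), poleTerm, mul_div_assoc]
  simp only [e]
  refine hasSum_integral_of_dominated_convergence
    (fun i x => M i * (x + E.a) ^ (-(E.d * s.re))) (fun i => ?_) (fun i => ?_) ?_ ?_ ?_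
  · refine ContinuousOn.aestronglyMeasurable (fun x hx => ?_) measurableSet_Ioi
    have hu : x + E.a ≠ 0 := by
      have := mem_Ioi.1 hx
      linarith
    exact (ContinuousAt.continuousWithinAt (by fun_prop (disch := assumption)))
  · filter_upwards [ae_restrict_mem measurableSet_Ioi] with x hx
    have hu : 0 < x + E.a := by linarith [mem_Ioi.1 hx]
    have hU : E.U ≤ x + E.a := by unfold U; linarith [mem_Ioi.1 hx]
    have hU0 := E.U_pos
    have e2 : ‖Complex.exp (-(E.d * s + 2 * i) * Real.log (x + E.a))‖ =
        (((x + E.a) ^ 2)⁻¹) ^ i * (x + E.a) ^ (-(E.d * s.re)) := by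
      rw [Complex.norm_exp, Complex.re_mul_ofReal, inv_pow, ← pow_mul,
        ← Real.exp_log (pow_pos hu (2 * i)), ← Real.exp_neg, Real.log_pow,
        Real.rpow_def_of_pos hu, ← Real.exp_add]
      congr 1
      simp
      ring
    rw [norm_mul, e2, ← mul_assoc]
    refine mul_le_mul_of_nonneg_right (le_trans ?_ (hMle i s le_rfl)) (by positivity)
    gcongr
  · exact Eventually.of_forall fun x => hM.mul_right _
  · simp only [tsum_mul_right]
    exact ((E.integrableOn_rpow hs).mono_set (Ioi_subset_Ioi (by norm_num : (0 : ℝ) ≤ 2))).const_mul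
      _
  · filter_upwards [ae_restrict_mem measurableSet_Ioi] with x hx using E.hasSum_F_zero s hx

/-- The part of `J` that is holomorphic in a half-plane growing with `N`. -/
noncomputable def regular (N : ℕ) (s : ℂ) : ℂ :=
  (∫ x in Ioc (0 : ℝ) 2, E.F 0 s x) + ∑' i, E.poleTerm (i + N) s

/-- The pole structure of `J`: the integral over `m / n ≤ 2` is entire, and beyond that the
expansion at infinity is integrated term by term. -/
theorem J_eq {s : ℂ} (hs : 1 < E.d * s.re) (N : ℕ) :
    E.J s = E.regular N s + ∑ i ∈ Finset.range N, E.poleTerm i s := by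
  have hF := E.integrableOn_F 0 (s := s) (by simpa using hs)
  have h := E.hasSum_poleTerm hs
  rw [J, ← Ioc_union_Ioi_eq_Ioi (show (0 : ℝ) ≤ 2 by norm_num),
    setIntegral_union (Set.Ioc_disjoint_Ioi le_rfl) measurableSet_Ioi
      (hF.mono_set Ioc_subset_Ioi_self)
      (hF.mono_set (Ioi_subset_Ioi (by norm_num))), regular, ← h.tsum_eq,
    ← h.summable.sum_add_tsum_nat_add N]
  ring

theorem differentiableOn_regular (N : ℕ) {σ : ℝ} (hN : 2 ≤ E.d * σ + 2 * N) :
    DifferentiableOn ℂ (E.regular N) {s | σ < s.re} := by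
  intro s hs
  set S := ‖s‖ + 1
  have hopen : IsOpen ({s : ℂ | σ < s.re} ∩ Metric.ball 0 S) :=
    (isOpen_lt continuous_const Complex.continuous_re).inter Metric.isOpen_ball
  have ha := E.a_pos
  suffices hd : DifferentiableOn ℂ (E.regular N) ({s | σ < s.re} ∩ Metric.ball 0 S) from
    (hd.differentiableAt (hopen.mem_nhds ⟨hs, by simp [S]⟩)).differentiableWithinAt
  refine DifferentiableOn.add ?_ ?_
  · obtain ⟨C, hC0, hC⟩ := E.exists_bound_F 0 S σ
    refine differentiableOn_integral_of_dominated hopen (fun s _ => ?_)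
      (Eventually.of_forall fun x => (E.differentiable_F 0 x).differentiableOn)
      (b := fun x => C * (x + E.a) ^ (-(E.d * σ + (0 : ℕ)))) ?_ ?_
    · exact ((E.continuousOn_F 0 s).mono fun x hx => le_of_lt hx.1).aestronglyMeasurable
        measurableSet_Ioc
    · refine Integrable.const_mul (IntegrableOn.mono_set (t := Icc 0 2) ?_ Ioc_subset_Icc_self) _
      refine ContinuousOn.integrableOn_Icc fun x hx => ?_
      have hu : x + E.a ≠ 0 := by
        have := hx.1
        linarith
      exact (ContinuousAt.continuousWithinAt
        (ContinuousAt.rpow_const (by fun_prop) (Or.inl hu)))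
    · filter_upwards [ae_restrict_mem measurableSet_Ioc] with x hx w hw
      exact hC w (mem_ball_zero_iff.1 hw.2).le (le_of_lt hw.1) x (le_of_lt hx.1)
  · obtain ⟨M, hM, hMle⟩ := E.exists_majorant S
    -- The denominators of the remaining terms are bounded below in the half-plane.
    have hden : ∀ i : ℕ, ∀ w ∈ {s : ℂ | σ < s.re} ∩ Metric.ball 0 S,
        1 ≤ ((E.d : ℂ) * w + 2 * (i + N : ℕ) - 1).re := by
      intro i w hw
      have h1 := mul_le_mul_of_nonneg_left (le_of_lt hw.1) (Nat.cast_nonneg (α := ℝ) E.d)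
      have : ((E.d : ℂ) * w + 2 * (i + N : ℕ) - 1).re = E.d * w.re + 2 * (i + N) - 1 := by simp
      rw [this]
      linarith [Nat.cast_nonneg (α := ℝ) i]
    refine Complex.differentiableOn_tsum_of_summable_norm
      (((summable_nat_add_iff N).2 hM).mul_right (E.U ^ (-(E.d * σ - 1)))) (fun i => ?_) hopen
      fun i w hw => ?_
    · refine DifferentiableOn.div ?_ (by fun_prop) ?_
      · exact ((E.differentiable_coef _).mul (by fun_prop)).differentiableOn
      · intro w hw h0
        have := hden i w hw
        rw [h0] at this
        norm_num at this
    · have hU0 := E.U_pos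
      have e2 : ‖Complex.exp (-(E.d * w + 2 * (i + N : ℕ) - 1) * Real.log E.U)‖ =
          ((E.U ^ 2)⁻¹) ^ (i + N) * E.U ^ (-(E.d * w.re - 1)) := by
        rw [Complex.norm_exp, Complex.re_mul_ofReal, inv_pow, ← pow_mul,
          ← Real.exp_log (pow_pos hU0 (2 * (i + N))), ← Real.exp_neg, Real.log_pow,
          Real.rpow_def_of_pos hU0, ← Real.exp_add]
        congr 1
        simp
        ring
      rw [poleTerm, norm_div, norm_mul, e2, ← mul_assoc]
      refine (div_le_self (by positivity) ?_).trans ?_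
      · exact (hden i w hw).trans (Complex.re_le_norm _)
      · refine mul_le_mul (hMle _ w (mem_ball_zero_iff.1 hw.2).le) ?_ (by positivity) ?_
        · refine Real.rpow_le_rpow_of_exponent_le E.one_le_U ?_
          have := mul_le_mul_of_nonneg_left (le_of_lt hw.1) (Nat.cast_nonneg (α := ℝ) E.d)
          linarith
        · exact le_trans (by positivity) (hMle _ w (mem_ball_zero_iff.1 hw.2).le)

theorem F_zero_ofReal (σ x : ℝ) : E.F 0 σ x =
    ((Real.exp (-(E.d * σ) * Real.log (x + E.a)) *
      (Real.exp (-σ * E.logR (1 / (x + E.a))) * E.cutoff (1 / (x + E.a))) : ℝ) : ℂ) := by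
  rw [F, E.symb_zero]
  push_cast
  simp

theorem J_re_pos {σ : ℝ} (hσ : 1 < E.d * σ) : 0 < (E.J σ).re := by
  have ha := E.a_pos
  have hF := E.integrableOn_F 0 (s := σ) (by simpa using hσ)
  have e : (E.J σ).re = ∫ x in Ioi (0 : ℝ), (E.F 0 σ x).re := (integral_re hF).symm
  rw [e, setIntegral_pos_iff_support_of_nonneg_ae (f := fun x => (E.F 0 σ x).re) _ hF.re]
  · have hsub : Ioo (2 : ℝ) 3 ⊆ Function.support (fun x => (E.F 0 σ x).re) ∩ Ioi 0 := by
      intro x hx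
      refine ⟨?_, lt_trans two_pos hx.1⟩
      have : E.cutoff (1 / (x + E.a)) = 1 := by
        have := hx.1
        exact E.cutoff_eq_one (by positivity)
          (one_div_le_one_div_of_le (by linarith) (by linarith))
      rw [Function.mem_support, F_zero_ofReal, Complex.ofReal_re, this]
      positivity
    refine lt_of_lt_of_le ?_ (measure_mono hsub)
    rw [Real.volume_Ioo]
    norm_num
  · refine Eventually.of_forall fun x => ?_
    simp only [Pi.zero_apply]
    rw [F_zero_ofReal, Complex.ofReal_re]
    have := E.cutoff_nonneg (1 / (x + E.a))
    positivity

end EdgeData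

/-! ### Meromorphic continuation through growing half-planes -/

theorem isOpen_re_gt (x : ℝ) : IsOpen {s : ℂ | x < s.re} :=
  isOpen_lt continuous_const Complex.continuous_re

/-- The identity theorem for meromorphic functions on a half-plane. -/
theorem eventuallyEq_of_meromorphicOn_halfPlane {f g : ℂ → ℂ} {x y : ℝ}
    (hf : MeromorphicOn f {s | x < s.re}) (hg : MeromorphicOn g {s | x < s.re})
    (heq : ∀ s : ℂ, y < s.re → f s = g s) {s₀ : ℂ} (hs₀ : x < s₀.re) :
    f =ᶠ[𝓝[≠] s₀] g := by
  have hconn : IsPreconnected {s : ℂ | x < s.re} :=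
    (convex_halfSpace_re_gt x).isPreconnected
  set z : ℂ := ((max x y + 1 : ℝ) : ℂ) with hz
  have hzx : x < z.re := by
    rw [hz, Complex.ofReal_re]; linarith [le_max_left x y]
  have hzy : y < z.re := by
    rw [hz, Complex.ofReal_re]; linarith [le_max_right x y]
  have htop : meromorphicOrderAt (f - g) z = ⊤ := by
    rw [meromorphicOrderAt_eq_top_iff]
    filter_upwards [mem_nhdsWithin_of_mem_nhds ((isOpen_re_gt y).mem_nhds hzy)] with w hw
    rw [Pi.sub_apply, heq w hw, sub_self]
  have h₀ : meromorphicOrderAt (f - g) s₀ = ⊤ := by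
    by_contra h
    exact (hf.sub hg).meromorphicOrderAt_ne_top_of_isPreconnected hconn hs₀ hzx h htop
  rw [meromorphicOrderAt_eq_top_iff] at h₀
  filter_upwards [h₀] with w hw
  exact sub_eq_zero.1 hw

/-- Meromorphic functions on the half-planes `Re s > -M` that agree on a fixed half-plane glue to
a meromorphic function on the plane. -/
theorem exists_meromorphicOn_univ {G : ℕ → ℂ → ℂ} {f : ℂ → ℂ} {y : ℝ}
    (hG : ∀ M : ℕ, MeromorphicOn (G M) {s | -(M : ℝ) < s.re})
    (heq : ∀ M : ℕ, ∀ s : ℂ, y < s.re → G M s = f s) :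
    ∃ W : ℂ → ℂ, MeromorphicOn W univ ∧ ∀ s : ℂ, y < s.re → W s = f s := by
  refine ⟨fun s => G (⌈-s.re⌉₊ + 1) s, fun s₀ _ => ?_, fun s hs => heq _ s hs⟩
  set N := ⌈-s₀.re⌉₊ + 2 with hN
  have hNs : -(N : ℝ) < s₀.re := by
    have := Nat.le_ceil (-s₀.re)
    rw [hN]; push_cast; linarith
  -- Near `s₀` only finitely many of the given functions occur, and each coincides with `G N`.
  have hall : ∀ᶠ s in 𝓝[≠] s₀, ∀ k ∈ Finset.range (N + 1), -(k : ℝ) < s₀.re → G N s = G k s := by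
    rw [eventually_all_finset]
    intro k _
    by_cases hk : -(k : ℝ) < s₀.re
    · have hkN : -((min k N : ℕ) : ℝ) < s₀.re := by
        rcases min_choice k N with h | h <;> rw [h] <;> assumption
      have hsub : ∀ j : ℕ, (min k N) ≤ j → MeromorphicOn (G j) {s | -((min k N : ℕ) : ℝ) < s.re} :=
        fun j hj s hs => hG j s (show -(j : ℝ) < s.re from
          lt_of_le_of_lt (neg_le_neg (Nat.cast_le.2 hj)) hs)
      filter_upwards [eventuallyEq_of_meromorphicOn_halfPlane (hsub N (min_le_right _ _))
        (hsub k (min_le_left _ _)) (fun s hs => (heq N s hs).trans (heq k s hs).symm) hkN]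
        with s hs _ using hs
    · exact Eventually.of_forall fun s h => absurd h hk
  have hnear : ∀ᶠ s in 𝓝[≠] s₀, |s.re - s₀.re| < 1 := by
    refine mem_nhdsWithin_of_mem_nhds (IsOpen.mem_nhds ?_ (by simp))
    exact isOpen_lt (by fun_prop) continuous_const
  refine (hG N s₀ hNs).congr ?_
  filter_upwards [hall, hnear] with s hs hn
  rw [abs_lt] at hn
  refine hs _ ?_ ?_
  · rw [Finset.mem_range, hN]
    have : ⌈-s.re⌉₊ ≤ ⌈-s₀.re⌉₊ + 1 := by
      rw [Nat.ceil_le]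
      push_cast
      linarith [Nat.le_ceil (-s₀.re)]
    omega
  · push_cast
    linarith [Nat.le_ceil (-s.re)]

/-! ### Local behaviour -/

theorem isSimplePoleAt_of_eventuallyEq {W h : ℂ → ℂ} {s₀ : ℂ} (hW : MeromorphicAt W s₀)
    (hh : AnalyticAt ℂ h s₀) (heq : W =ᶠ[𝓝[≠] s₀] fun s => (s - s₀)⁻¹ * h s) (h0 : h s₀ ≠ 0) :
    IsSimplePoleAt W s₀ := by
  refine ⟨hW, (meromorphicOrderAt_eq_int_iff hW).2 ⟨h, hh, h0, ?_⟩⟩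
  filter_upwards [heq] with s hs
  rw [hs, zpow_neg_one, smul_eq_mul]

/-- `W` has at most a removable singularity at `s₀`. -/
def IsRegularAt (W : ℂ → ℂ) (s₀ : ℂ) : Prop := ¬ IsPoleAt W s₀ ∧ HasResidueAt W s₀ 0

theorem isRegularAt_of_eventuallyEq_analyticAt {W g : ℂ → ℂ} {s₀ : ℂ} (hg : AnalyticAt ℂ g s₀)
    (heq : W =ᶠ[𝓝[≠] s₀] g) : IsRegularAt W s₀ := by
  refine ⟨fun h => ?_, ?_⟩
  · have h1 := hg.meromorphicOrderAt_nonneg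
    rw [← meromorphicOrderAt_congr heq] at h1
    exact absurd h.2 (not_lt.2 h1)
  · obtain ⟨r, hr, hball⟩ := Metric.eventually_nhds_iff_ball.1
      (hg.eventually_analyticAt.and (eventually_nhdsWithin_iff.1 heq))
    rw [HasResidueAt, eventually_nhdsWithin_iff]
    filter_upwards [Iio_mem_nhds hr] with ρ hρ hρ0
    have hρ0 : 0 < ρ := hρ0
    have hsub : Metric.closedBall s₀ ρ ⊆ Metric.ball s₀ r := Metric.closedBall_subset_ball hρ
    rw [circleIntegral.integral_congr hρ0.le (g := g)]
    · have hd : DifferentiableOn ℂ g (Metric.closedBall s₀ ρ) := fun z hz =>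
        (hball z (hsub hz)).1.differentiableAt.differentiableWithinAt
      have hcl : DiffContOnCl ℂ g (Metric.ball s₀ ρ) := by
        refine DifferentiableOn.diffContOnCl ?_
        rwa [closure_ball _ hρ0.ne']
      rw [hcl.circleIntegral_eq_zero hρ0.le, mul_zero]
    · intro z hz
      refine (hball z (hsub (Metric.sphere_subset_closedBall hz))).2 ?_
      intro h
      rw [mem_singleton_iff.1 h, Metric.mem_sphere, dist_self] at hz
      exact hρ0.ne hz

theorem isRegularAt_of_eventuallyEq {W h : ℂ → ℂ} {s₀ : ℂ}
    (hh : AnalyticAt ℂ h s₀) (heq : W =ᶠ[𝓝[≠] s₀] fun s => (s - s₀)⁻¹ * h s) (h0 : h s₀ = 0) :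
    IsRegularAt W s₀ := by
  obtain ⟨p, hp⟩ := hh
  refine isRegularAt_of_eventuallyEq_analyticAt
    (hp.has_fpower_series_dslope_fslope.analyticAt) (heq.trans ?_)
  filter_upwards [self_mem_nhdsWithin] with s hs
  rw [dslope_of_ne _ hs, slope_def_module, h0, sub_zero, smul_eq_mul]

/-! ### The shape of the continuation -/

/-- The continuation in a half-plane: `ζ ((d + 1) s - 1)` times a function with explicit simple
poles at `d s = 1 - 2 i`, plus a holomorphic function. The pole of `ζ` is split off. -/
noncomputable def model (d N : ℕ) (ψ : ℕ → ℂ → ℂ) (A R : ℂ → ℂ) (s : ℂ) : ℂ :=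
  ((d + 1) * s - 2)⁻¹ * riemannZeta₁ ((d + 1) * s - 1) *
    (A s + ∑ i ∈ Finset.range N, (d * s + 2 * i - 1)⁻¹ * ψ i s) + R s

/-- The series with terms `a s` is given by `model` functions in arbitrarily large half-planes.
The inequality for `N` says that the points `d s = 1 - 2 i` with `i ≥ N` lie outside the half-plane;
the last condition says that the factor of `ζ` does not vanish at the pole of
`ζ ((d + 1) s - 1)`. -/
def HasExpansion (d : ℕ) (ψ : ℕ → ℂ → ℂ) (a : ℂ → ℕ+ × ℕ+ → ℂ) : Prop :=
  (∀ i, Differentiable ℂ (ψ i)) ∧ ∀ M : ℕ, ∃ (N : ℕ) (A R : ℂ → ℂ),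
    2 ≤ -((d : ℝ) * M) + 2 * N ∧
    DifferentiableOn ℂ A {s | -(M : ℝ) < s.re} ∧ DifferentiableOn ℂ R {s | -(M : ℝ) < s.re} ∧
    (∀ s : ℂ, 2 / (d + 1 : ℝ) < s.re → HasSum (a s) (model d N ψ A R s)) ∧
    0 < (A (2 / (d + 1)) + ∑ i ∈ Finset.range N,
      (d * (2 / (d + 1)) + 2 * i - 1 : ℂ)⁻¹ * ψ i (2 / (d + 1))).re

theorem meromorphicOn_model {d N : ℕ} {ψ : ℕ → ℂ → ℂ} {A R : ℂ → ℂ} {x : ℝ}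
    (hψ : ∀ i, Differentiable ℂ (ψ i)) (hA : DifferentiableOn ℂ A {s | x < s.re})
    (hR : DifferentiableOn ℂ R {s | x < s.re}) :
    MeromorphicOn (model d N ψ A R) {s | x < s.re} := by
  intro s hs
  have hA' := (hA.analyticAt ((isOpen_re_gt x).mem_nhds hs)).meromorphicAt
  have hR' := (hR.analyticAt ((isOpen_re_gt x).mem_nhds hs)).meromorphicAt
  have hψ' : ∀ i, MeromorphicAt (ψ i) s := fun i => ((hψ i).analyticAt s).meromorphicAt
  have hζ : MeromorphicAt (fun s : ℂ => riemannZeta₁ ((d + 1) * s - 1)) s :=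
    (Differentiable.analyticAt (by fun_prop) s).meromorphicAt
  have hlin : ∀ b c : ℂ, MeromorphicAt (fun s : ℂ => b * s - c) s := fun b c =>
    (Differentiable.analyticAt (by fun_prop) s).meromorphicAt
  have hlin' : ∀ b c : ℂ, MeromorphicAt (fun s : ℂ => b * s + c - 1) s := fun b c =>
    (Differentiable.analyticAt (by fun_prop) s).meromorphicAt
  refine (((hlin _ _).inv.mul hζ).mul (hA'.add ?_)).add hR'
  refine MeromorphicAt.fun_sum fun i _ => ?_
  exact (hlin' _ _).inv.mul (hψ' i)

namespace HasExpansion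

variable {d : ℕ} {ψ : ℕ → ℂ → ℂ} {a : ℂ → ℕ+ × ℕ+ → ℂ}

theorem exists_continuation (h : HasExpansion d ψ a) :
    ∃ W, IsMeromorphicContinuation a (2 / (d + 1)) W := by
  choose N A R hN hA hR hsum hpos using h.2
  obtain ⟨W, hW, hWeq⟩ := exists_meromorphicOn_univ (y := 2 / (d + 1 : ℝ))
    (f := fun s => ∑' p, a s p)
    (fun M => meromorphicOn_model h.1 (hA M) (hR M)) fun M s hs => (hsum M s hs).tsum_eq.symm
  refine ⟨W, hW, fun s hs => ?_⟩
  rw [hWeq s hs]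
  exact (hsum 0 s hs).summable.hasSum

/-- Near any point, every continuation coincides with a `model` whose poles include all the
possible ones there. -/
theorem exists_model (h : HasExpansion d ψ a) {W : ℂ → ℂ}
    (hW : IsMeromorphicContinuation a (2 / (d + 1)) W) (s₀ : ℂ) :
    ∃ (N : ℕ) (A R : ℂ → ℂ), (∀ i : ℕ, N ≤ i → (d : ℂ) * s₀ + 2 * i - 1 ≠ 0) ∧
      AnalyticAt ℂ A s₀ ∧ AnalyticAt ℂ R s₀ ∧ W =ᶠ[𝓝[≠] s₀] model d N ψ A R ∧
      0 < (A (2 / (d + 1)) + ∑ i ∈ Finset.range N,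
        (d * (2 / (d + 1)) + 2 * i - 1 : ℂ)⁻¹ * ψ i (2 / (d + 1))).re := by
  set M := ⌈-s₀.re⌉₊ + 1 with hM
  have hMs : -(M : ℝ) < s₀.re := by
    have := Nat.le_ceil (-s₀.re)
    rw [hM]; push_cast; linarith
  obtain ⟨N, A, R, hN, hA, hR, hsum, hpos⟩ := h.2 M
  have hnhds := (isOpen_re_gt (-(M : ℝ))).mem_nhds hMs
  refine ⟨N, A, R, fun i hi h0 => ?_, hA.analyticAt hnhds, hR.analyticAt hnhds, ?_, hpos⟩
  · have h1 := congrArg Complex.re h0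
    have h2 : ((d : ℂ) * s₀ + 2 * i - 1).re = d * s₀.re + 2 * i - 1 := by simp
    rw [h2, Complex.zero_re] at h1
    have h3 : (N : ℝ) ≤ i := by exact_mod_cast hi
    have h4 := mul_le_mul_of_nonneg_left hMs.le (Nat.cast_nonneg (α := ℝ) d)
    linarith
  · exact eventuallyEq_of_meromorphicOn_halfPlane (fun s _ => hW.1 s (mem_univ s))
      (meromorphicOn_model h.1 hA hR)
      (fun s hs => (hW.2 s hs).unique (hsum s hs)) hMs

theorem analyticAt_zeta₁ (s₀ : ℂ) :
    AnalyticAt ℂ (fun s : ℂ => riemannZeta₁ ((d + 1) * s - 1)) s₀ :=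
  Differentiable.analyticAt (by fun_prop) s₀

theorem analyticAt_sum (hψ : ∀ i, Differentiable ℂ (ψ i)) {s₀ : ℂ} (I : Finset ℕ)
    (hI : ∀ i ∈ I, (d : ℂ) * s₀ + 2 * i - 1 ≠ 0) :
    AnalyticAt ℂ (fun s => ∑ i ∈ I, ((d : ℂ) * s + 2 * i - 1)⁻¹ * ψ i s) s₀ := by
  refine Finset.analyticAt_fun_sum _ fun i hi => ?_
  refine AnalyticAt.mul (AnalyticAt.inv (Differentiable.analyticAt (by fun_prop) s₀) (hI i hi))
    ((hψ i).analyticAt s₀)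

theorem isRegularAt (h : HasExpansion d ψ a) {W : ℂ → ℂ}
    (hW : IsMeromorphicContinuation a (2 / (d + 1)) W) {s₀ : ℂ} (h1 : s₀ ≠ 2 / (d + 1))
    (h2 : ∀ i : ℕ, (d : ℂ) * s₀ + 2 * i - 1 ≠ 0) : IsRegularAt W s₀ := by
  obtain ⟨N, A, R, -, hA, hR, heq, -⟩ := h.exists_model hW s₀
  refine isRegularAt_of_eventuallyEq_analyticAt ?_ heq
  have hD : ((d : ℂ) + 1) ≠ 0 := Nat.cast_add_one_ne_zero d
  refine ((AnalyticAt.mul (AnalyticAt.inv (Differentiable.analyticAt (by fun_prop) s₀) ?_)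
    (analyticAt_zeta₁ s₀)).mul (hA.add (analyticAt_sum h.1 _ fun i _ => h2 i))).add hR
  intro h0
  apply h1
  rw [eq_div_iff hD]
  linear_combination h0

theorem isSimplePoleAt_zeta (h : HasExpansion d ψ a) (hd : 2 ≤ d) {W : ℂ → ℂ}
    (hW : IsMeromorphicContinuation a (2 / (d + 1)) W) : IsSimplePoleAt W (2 / (d + 1)) := by
  set s₀ : ℂ := 2 / (d + 1) with hs₀
  obtain ⟨N, A, R, -, hA, hR, heq, hpos⟩ := h.exists_model hW s₀
  have hD : ((d : ℂ) + 1) ≠ 0 := Nat.cast_add_one_ne_zero d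
  have hDs : ((d : ℂ) + 1) * s₀ = 2 := by rw [hs₀]; field_simp
  have h2 : ∀ i : ℕ, (d : ℂ) * s₀ + 2 * i - 1 ≠ 0 := by
    intro i h0
    have h1 : ((d : ℂ) + 1) * ((d : ℂ) * s₀ + 2 * i - 1) = ((2 * d + (d + 1) * (2 * i) : ℕ) : ℂ) -
        ((d + 1 : ℕ) : ℂ) := by
      push_cast
      linear_combination (d : ℂ) * hDs
    rw [h0, mul_zero, eq_comm, sub_eq_zero, Nat.cast_inj] at h1
    nlinarith
  refine isSimplePoleAt_of_eventuallyEq (hW.1 s₀ (mem_univ _))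
    (h := fun s => ((d : ℂ) + 1)⁻¹ * riemannZeta₁ ((d + 1) * s - 1) *
      (A s + ∑ i ∈ Finset.range N, (d * s + 2 * i - 1)⁻¹ * ψ i s) + (s - s₀) * R s) ?_ ?_ ?_
  · refine ((analyticAt_const.mul (analyticAt_zeta₁ s₀)).mul
      (hA.add (analyticAt_sum h.1 _ fun i _ => h2 i))).add (AnalyticAt.mul ?_ hR)
    exact Differentiable.analyticAt (by fun_prop) s₀
  · filter_upwards [heq, self_mem_nhdsWithin] with s hs hne
    have hne' : s - s₀ ≠ 0 := sub_ne_zero.2 hne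
    have e : ((d : ℂ) + 1) * s - 2 = (d + 1) * (s - s₀) := by linear_combination hDs
    rw [hs, model, e, mul_inv, mul_add (s - s₀)⁻¹, inv_mul_cancel_left₀ hne']
    ring
  · simp only [sub_self, zero_mul, add_zero, hDs]
    have e : (2 : ℂ) - 1 = 1 := by norm_num
    rw [e, riemannZeta₁_one, mul_one]
    refine mul_ne_zero (inv_ne_zero hD) fun h0 => ?_
    rw [h0] at hpos
    simp at hpos

/-- At the point `d s = 1 - 2 i` there is a simple pole or a removable singularity, according to
the value of `ζ ((d + 1) s - 1) * ψ i s`. -/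
theorem local_at_edge_point (h : HasExpansion d ψ a) {W : ℂ → ℂ}
    (hW : IsMeromorphicContinuation a (2 / (d + 1)) W) {s₀ : ℂ} {i : ℕ} (hd : 0 < d)
    (h1 : s₀ ≠ 2 / (d + 1)) (h2 : (d : ℂ) * s₀ + 2 * i - 1 = 0) :
    (riemannZeta ((d + 1) * s₀ - 1) * ψ i s₀ ≠ 0 → IsSimplePoleAt W s₀) ∧
    (riemannZeta ((d + 1) * s₀ - 1) * ψ i s₀ = 0 → IsRegularAt W s₀) := by
  obtain ⟨N, A, R, hN, hA, hR, heq, -⟩ := h.exists_model hW s₀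
  have hD : ((d : ℂ) + 1) ≠ 0 := Nat.cast_add_one_ne_zero d
  have hdc : (d : ℂ) ≠ 0 := Nat.cast_ne_zero.2 hd.ne'
  have hiN : i ∈ Finset.range N := by
    rw [Finset.mem_range]
    by_contra hi
    exact hN i (not_lt.1 hi) h2
  have hne1 : ((d : ℂ) + 1) * s₀ - 2 ≠ 0 := by
    intro h0
    apply h1
    rw [eq_div_iff hD]
    linear_combination h0
  -- `g` is `(s - s₀)` times the model, with the `i`-th term of the sum taken out.
  set q : ℂ → ℂ := fun s => ((d : ℂ) + 1) * s - 2
  set g : ℂ → ℂ := fun s => (q s)⁻¹ * riemannZeta₁ ((d + 1) * s - 1) *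
      ((d : ℂ)⁻¹ * ψ i s + (s - s₀) * (A s + ∑ j ∈ (Finset.range N).erase i,
        ((d : ℂ) * s + 2 * j - 1)⁻¹ * ψ j s)) + (s - s₀) * R s with hg
  have hsub : AnalyticAt ℂ (fun s => s - s₀) s₀ := Differentiable.analyticAt (by fun_prop) s₀
  have hga : AnalyticAt ℂ g s₀ := by
    refine ((AnalyticAt.mul (AnalyticAt.inv (Differentiable.analyticAt (by fun_prop) s₀) hne1)
      (analyticAt_zeta₁ s₀)).mul ((analyticAt_const.mul ((h.1 i).analyticAt s₀)).add
      (hsub.mul (hA.add (analyticAt_sum h.1 _ fun j hj h0 => ?_))))).add (hsub.mul hR)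
    refine Finset.ne_of_mem_erase hj ?_
    have : (2 : ℂ) * (j - i) = 0 := by linear_combination h0 - h2
    have := (mul_eq_zero.1 this).resolve_left two_ne_zero
    exact_mod_cast sub_eq_zero.1 this
  have hgeq : W =ᶠ[𝓝[≠] s₀] fun s => (s - s₀)⁻¹ * g s := by
    filter_upwards [heq, self_mem_nhdsWithin] with s hs hne
    have hne' : s - s₀ ≠ 0 := sub_ne_zero.2 hne
    have e : (d : ℂ) * s + 2 * i - 1 = d * (s - s₀) := by linear_combination h2
    rw [hs, model, ← Finset.add_sum_erase _ _ hiN, e, mul_inv]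
    simp only [hg]
    field_simp
    ring
  have hval : g s₀ = (d : ℂ)⁻¹ * (riemannZeta ((d + 1) * s₀ - 1) * ψ i s₀) := by
    have : ((d : ℂ) + 1) * s₀ - 1 ≠ 1 := fun h0 => hne1 (by linear_combination h0)
    rw [riemannZeta_eq_inv_sub_mul this]
    simp only [hg, q, sub_self, zero_mul, add_zero]
    have : ((d : ℂ) + 1) * s₀ - 1 - 1 = (d + 1) * s₀ - 2 := by ring
    rw [this]
    ring
  refine ⟨fun h0 => isSimplePoleAt_of_eventuallyEq (hW.1 s₀ (mem_univ _)) hga hgeq ?_,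
    fun h0 => isRegularAt_of_eventuallyEq hga hgeq ?_⟩
  · rw [hval]
    exact mul_ne_zero (inv_ne_zero hdc) h0
  · rw [hval, h0, mul_zero]

end HasExpansion

/-! ### Zeros of the Riemann zeta function on the real line -/

/-- The integral of the fractional part that occurs in the continuation of `ζ` to `Re s > 0`. -/
noncomputable def fractIntegral (s : ℂ) : ℂ :=
  ∫ t in Ioi (1 : ℝ), ((Int.fract t : ℝ) : ℂ) * (t : ℂ) ^ (-(s + 1))

theorem norm_fract_mul_cpow_le {t : ℝ} (ht : 1 < t) (s : ℂ) :
    ‖((Int.fract t : ℝ) : ℂ) * (t : ℂ) ^ (-(s + 1))‖ ≤ t ^ (-(s.re + 1)) := by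
  rw [norm_mul, Complex.norm_real, Complex.norm_cpow_eq_rpow_re_of_pos (by linarith),
    Real.norm_of_nonneg (Int.fract_nonneg t)]
  have e : (-(s + 1)).re = -(s.re + 1) := by simp
  rw [e]
  exact mul_le_of_le_one_left (by positivity) (Int.fract_lt_one t).le

theorem aestronglyMeasurable_fract_mul_cpow (s : ℂ) :
    AEStronglyMeasurable (fun t : ℝ => ((Int.fract t : ℝ) : ℂ) * (t : ℂ) ^ (-(s + 1)))
      (volume.restrict (Ioi 1)) := by
  refine AEStronglyMeasurable.mul
    (Complex.measurable_ofReal.comp measurable_fract).aestronglyMeasurable ?_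
  refine ContinuousOn.aestronglyMeasurable (fun t ht => ?_) measurableSet_Ioi
  have ht : (1 : ℝ) < t := ht
  exact (Complex.continuousAt_ofReal_cpow_const _ _ (Or.inr (by linarith))).continuousWithinAt

theorem differentiableOn_fractIntegral : DifferentiableOn ℂ fractIntegral {s | 0 < s.re} := by
  intro s hs
  have hs : 0 < s.re := hs
  have hd : DifferentiableOn ℂ fractIntegral {w | s.re / 2 < w.re} := by
    refine differentiableOn_integral_of_dominated (isOpen_re_gt _)
      (fun w _ => aestronglyMeasurable_fract_mul_cpow w) ?_
      (b := fun t : ℝ => t ^ (-(s.re / 2 + 1)))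
      (integrableOn_Ioi_rpow_of_lt (by linarith) one_pos) ?_
    · filter_upwards [ae_restrict_mem measurableSet_Ioi] with t ht
      have ht : (1 : ℝ) < t := ht
      have ht0 : (t : ℂ) ≠ 0 := by
        have : t ≠ 0 := by linarith
        exact_mod_cast this
      refine DifferentiableOn.const_mul (DifferentiableOn.const_cpow (by fun_prop) (Or.inl ht0)) _
    · filter_upwards [ae_restrict_mem measurableSet_Ioi] with t ht w hw
      have ht : (1 : ℝ) < t := ht
      have hw : s.re / 2 < w.re := hw
      refine (norm_fract_mul_cpow_le ht w).trans ?_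
      exact Real.rpow_le_rpow_of_exponent_le ht.le (by linarith)
  exact (hd.differentiableAt ((isOpen_re_gt _).mem_nhds (by
    show s.re / 2 < s.re
    linarith))).differentiableWithinAt

theorem riemannZeta_eq_fractIntegral {s : ℂ} (hs : 1 < s.re) :
    riemannZeta s = s / (s - 1) - s * fractIntegral s := by
  have hne : s - 1 ≠ 0 := by
    intro h
    have := congrArg Complex.re h
    simp at this
    linarith
  rw [← LSeries_one_eq_riemannZeta hs, LSeries_eq_mul_integral 1 zero_le_one hs
    (LSeriesSummable_one_iff.2 hs)]
  · have e : ∀ t ∈ Ioi (1 : ℝ), (∑ k ∈ Finset.Icc 1 ⌊t⌋₊, (1 : ℕ → ℂ) k) * (t : ℂ) ^ (-(s + 1)) =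
        (t : ℂ) ^ (-s) - ((Int.fract t : ℝ) : ℂ) * (t : ℂ) ^ (-(s + 1)) := by
      intro t ht
      have ht : (1 : ℝ) < t := ht
      have ht0 : (t : ℂ) ≠ 0 := by
        have : t ≠ 0 := by linarith
        exact_mod_cast this
      have h1 : (∑ k ∈ Finset.Icc 1 ⌊t⌋₊, (1 : ℕ → ℂ) k) = (t : ℂ) - ((Int.fract t : ℝ) : ℂ) := by
        simp only [Pi.one_apply, Finset.sum_const, Nat.card_Icc, add_tsub_cancel_right,
          nsmul_eq_mul, mul_one]
        rw [← Complex.ofReal_sub, Int.self_sub_fract, ← natCast_floor_eq_intCast_floor (by linarith)]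
        simp
      have h2 : (t : ℂ) ^ (-s) = t * (t : ℂ) ^ (-(s + 1)) := by
        have h3 : -s = 1 + -(s + 1) := by ring
        nth_rewrite 1 [h3]
        rw [Complex.cpow_add _ _ ht0, Complex.cpow_one]
      rw [h1, h2]
      ring
    rw [setIntegral_congr_fun measurableSet_Ioi e, integral_sub, ← fractIntegral,
      integral_Ioi_cpow_of_lt (by simpa using hs) one_pos]
    · simp only [Complex.ofReal_one, Complex.one_cpow]
      have : -s + 1 ≠ 0 := fun h => hne (by linear_combination -h)
      field_simp
      ring
    · exact integrableOn_Ioi_cpow_of_lt (by simpa using hs) one_pos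
    · refine Integrable.mono' (integrableOn_Ioi_rpow_of_lt (a := -(s.re + 1)) (by linarith)
        one_pos) (aestronglyMeasurable_fract_mul_cpow s) ?_
      filter_upwards [ae_restrict_mem measurableSet_Ioi] with t ht using norm_fract_mul_cpow_le ht s
  · refine Asymptotics.isBigO_of_le _ fun n => ?_
    simp

theorem riemannZeta₁_eq_fractIntegral {s : ℂ} (hs : 0 < s.re) :
    riemannZeta₁ s = s - s * (s - 1) * fractIntegral s := by
  have h1 : AnalyticOnNhd ℂ riemannZeta₁ {s | 0 < s.re} :=
    differentiable_riemannZeta₁.differentiableOn.analyticOnNhd (isOpen_re_gt 0)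
  have h2 : AnalyticOnNhd ℂ (fun s => s - s * (s - 1) * fractIntegral s) {s | 0 < s.re} := by
    refine DifferentiableOn.analyticOnNhd ?_ (isOpen_re_gt 0)
    exact DifferentiableOn.sub (by fun_prop)
      (DifferentiableOn.mul (by fun_prop) differentiableOn_fractIntegral)
  refine h1.eqOn_of_preconnected_of_eventuallyEq h2 (convex_halfSpace_re_gt 0).isPreconnected
    (z₀ := 2) (by simp) ?_ hs
  filter_upwards [(isOpen_re_gt 1).mem_nhds (show (1 : ℝ) < (2 : ℂ).re by simp)] with w hw
  have hw : 1 < w.re := hw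
  have hne : w ≠ 1 := by
    rintro rfl
    simp at hw
  have hne' : w - 1 ≠ 0 := sub_ne_zero.2 hne
  have h3 := riemannZeta_eq_fractIntegral hw
  rw [riemannZeta_eq_inv_sub_mul hne] at h3
  field_simp at h3
  linear_combination h3

/-- On `(0, 1)` the formula `ζ s = s / (s - 1) - s ∫ {t} t ^ (-s - 1)` has both terms negative. -/
theorem riemannZeta_ne_zero_of_mem_Ioo {σ : ℝ} (h0 : 0 < σ) (h1 : σ < 1) :
    riemannZeta (σ : ℂ) ≠ 0 := by
  have hne : (σ : ℂ) ≠ 1 := by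
    intro h
    have : σ = 1 := by exact_mod_cast h
    linarith
  intro h
  rw [riemannZeta_eq_inv_sub_mul hne, mul_eq_zero] at h
  have h2 := h.resolve_left (inv_ne_zero (sub_ne_zero.2 hne))
  rw [riemannZeta₁_eq_fractIntegral (by simpa using h0)] at h2
  obtain ⟨I, hI0, hI⟩ : ∃ I : ℝ, 0 ≤ I ∧ fractIntegral σ = I := by
    refine ⟨∫ t in Ioi (1 : ℝ), Int.fract t * t ^ (-(σ + 1)), ?_, ?_⟩
    · refine setIntegral_nonneg measurableSet_Ioi fun t ht => ?_
      have ht : (1 : ℝ) < t := ht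
      have := Int.fract_nonneg t
      positivity
    · rw [fractIntegral, ← integral_complex_ofReal]
      refine setIntegral_congr_fun measurableSet_Ioi fun t ht => ?_
      have ht : (1 : ℝ) < t := ht
      rw [Complex.ofReal_mul, Complex.ofReal_cpow (by linarith)]
      push_cast
      rfl
  rw [hI] at h2
  have h3 : σ - σ * (σ - 1) * I = 0 := by exact_mod_cast h2
  nlinarith [mul_nonneg (mul_nonneg h0.le (sub_pos.2 h1).le) hI0]

/-- By the functional equation, the only zeros of `ζ` on the negative real axis are integers. -/
theorem riemannZeta_ne_zero_of_neg {x : ℝ} (hx : x < 0) (hint : ∀ n : ℤ, x ≠ n) :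
    riemannZeta (x : ℂ) ≠ 0 := by
  have hs1 : 1 < (1 - (x : ℂ)).re := by
    rw [Complex.sub_re, Complex.one_re, Complex.ofReal_re]; linarith
  have e : (x : ℂ) = 1 - (1 - x) := by ring
  have hne : ∀ n : ℕ, (1 - (x : ℂ)) ≠ -n := by
    intro n h
    have := congrArg Complex.re h
    simp at this
    linarith [Nat.cast_nonneg (α := ℝ) n]
  have hne1 : (1 - (x : ℂ)) ≠ 1 := by
    intro h
    rw [h] at hs1
    simp at hs1
  rw [e, riemannZeta_one_sub hne hne1]
  refine mul_ne_zero (mul_ne_zero (mul_ne_zero (mul_ne_zero two_ne_zero ?_) ?_) ?_) ?_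
  · rw [Complex.cpow_def_of_ne_zero]
    · exact Complex.exp_ne_zero _
    · have : (Real.pi : ℂ) ≠ 0 := Complex.ofReal_ne_zero.2 Real.pi_ne_zero
      exact mul_ne_zero two_ne_zero this
  · exact Complex.Gamma_ne_zero hne
  · rw [Ne, Complex.cos_eq_zero_iff]
    rintro ⟨k, hk⟩
    have hpi : (Real.pi : ℂ) ≠ 0 := Complex.ofReal_ne_zero.2 Real.pi_ne_zero
    have h2 : (1 - (x : ℂ)) = 2 * k + 1 := by
      field_simp at hk
      linear_combination hk
    have h3 : (1 - x : ℝ) = 2 * k + 1 := by exact_mod_cast h2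
    exact hint (-2 * k) (by push_cast; linarith)
  · exact riemannZeta_ne_zero_of_one_le_re hs1.le

/-! ### Splitting the series into two cones -/

theorem smoothTransition_add_one_sub (x : ℝ) :
    Real.smoothTransition x + Real.smoothTransition (1 - x) = 1 := by
  have h := (Real.smoothTransition.pos_denom x).ne'
  rw [Real.smoothTransition, Real.smoothTransition, sub_sub_cancel,
    add_comm (expNegInvGlue (1 - x)), ← add_div, div_self h]

namespace EdgeData

variable (E : EdgeData)

/-- The product of linear forms described by the edge data, at `m = x` and `n = y`. -/
noncomputable def form (x y : ℝ) : ℝ :=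
  y ^ (E.d + 1) * ((x / y + E.a) ^ E.d * (E.C * (1 - E.b₁ * (1 / (x / y + E.a)) ^ 2) *
    (1 - E.b₂ * (1 / (x / y + E.a)) ^ 2)))

/-- In the original variables the cutoff is a function of `x / (x + y)` that does not depend on the
edge. -/
theorem cutoff_eq {x y : ℝ} (hx : 0 < x) (hy : 0 < y) :
    E.cutoff (1 / (x / y + E.a)) = Real.smoothTransition (3 * x / (x + y) - 1) := by
  have ha := E.a_pos
  have hq : 0 < x / y := by positivity
  rw [cutoff, if_pos (one_div_lt_one_div_of_lt ha (by linarith))]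
  congr 2
  have h1 : (1 + (1 - E.a) * (1 / (x / y + E.a))) = (x / y + 1) / (x / y + E.a) := by
    field_simp
    ring
  have h2 : 3 * (1 - E.a * (1 / (x / y + E.a))) = 3 * (x / y) / (x / y + E.a) := by
    field_simp
    ring
  rw [h1, h2, div_div_div_cancel_right₀ (by positivity)]
  field_simp

theorem term_eq (s : ℂ) (n m : ℕ) :
    E.term s (n, m) = Complex.exp (-s * Real.log (E.form (m + 1 : ℕ) (n + 1 : ℕ))) *
      (Real.smoothTransition (3 * (m + 1 : ℕ) / ((m + 1 : ℕ) + (n + 1 : ℕ)) - 1) : ℝ) := by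
  have ha := E.a_pos
  have hx : (0 : ℝ) < (m + 1 : ℕ) := by positivity
  have hy : (0 : ℝ) < (n + 1 : ℕ) := by positivity
  generalize hx' : ((m + 1 : ℕ) : ℝ) = x at hx
  generalize hy' : ((n + 1 : ℕ) : ℝ) = y at hy
  have hu : 0 < x / y + E.a := by positivity
  have hv0 : 0 < 1 / (x / y + E.a) := by positivity
  have hr := E.r_pos (v := 1 / (x / y + E.a)) (by linarith)
    (one_div_lt_one_div_of_lt ha (by have : 0 < x / y := by positivity
                                     linarith))
  rw [← E.cutoff_eq hx hy, term, F, E.symb_zero]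
  simp only [hx', hy']
  rw [form, Real.log_mul (by positivity) (by positivity), Real.log_mul (by positivity) hr.ne',
    Real.log_pow, Real.log_pow, ← logR, ← mul_assoc, ← mul_assoc, ← Complex.exp_add,
    ← Complex.exp_add]
  congr 2
  push_cast
  ring

/-- The numerator of the pole at `d s = 1 - 2 i` in the sum of the functions `J` of two edges. The
exponential factors are `1` at the point itself (`poleNumerator_eq`). -/
noncomputable def poleNumerator (E₁ E₂ : EdgeData) (i : ℕ) (s : ℂ) : ℂ :=
  E₁.coef i s * Complex.exp (-(E₁.d * s + 2 * i - 1) * Real.log E₁.U) +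
    E₂.coef i s * Complex.exp (-(E₂.d * s + 2 * i - 1) * Real.log E₂.U)

theorem poleNumerator_eq (E₁ E₂ : EdgeData) (hd : E₂.d = E₁.d) {i : ℕ} {s : ℂ}
    (h : (E₁.d : ℂ) * s + 2 * i - 1 = 0) :
    poleNumerator E₁ E₂ i s = E₁.coef i s + E₂.coef i s := by
  simp [poleNumerator, hd, h]

theorem poleTerm_add (E₁ E₂ : EdgeData) (hd : E₂.d = E₁.d) (i : ℕ) (s : ℂ) :
    E₁.poleTerm i s + E₂.poleTerm i s =
      ((E₁.d : ℂ) * s + 2 * i - 1)⁻¹ * poleNumerator E₁ E₂ i s := by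
  simp only [poleNumerator, poleTerm, hd]
  ring

/-- If the product `P` is described by edge data at both edges, the smooth partition of unity splits
the series into the sums over the two cones. -/
theorem hasExpansion_of_edges (E₁ E₂ : EdgeData) (hd : E₂.d = E₁.d) (hd2 : 2 ≤ E₁.d)
    {a : ℂ → ℕ+ × ℕ+ → ℂ} {P : ℝ → ℝ → ℝ} (h₁ : ∀ x y : ℝ, 0 < x → 0 < y → E₁.form x y = P x y)
    (h₂ : ∀ x y : ℝ, 0 < x → 0 < y → E₂.form y x = P x y) {k : ℕ} (hk : E₁.d + 1 = 2 * k)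
    (hP : ∀ x y : ℝ, 0 < x → 0 < y → (x * y) ^ k ≤ P x y)
    (ha : ∀ (s : ℂ) (p : ℕ+ × ℕ+), a s p = Complex.exp (-s * Real.log (P p.1 p.2))) :
    HasExpansion E₁.d (poleNumerator E₁ E₂) a := by
  set d := E₁.d with hdd
  refine ⟨fun i => ?_, fun M => ?_⟩
  · unfold poleNumerator
    have := E₁.differentiable_coef i
    have := E₂.differentiable_coef i
    fun_prop
  -- With this `K` both the remainders and the tails of `J` are holomorphic in `Re s > -M`.
  set K := (d + 1) * M + 2 with hK
  have hdR : (2 : ℝ) ≤ d := by exact_mod_cast hd2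
  have hcond : 2 ≤ (d : ℝ) * (-(M : ℝ)) + 2 * (K : ℕ) := by
    rw [hK]; push_cast; nlinarith [Nat.cast_nonneg (α := ℝ) M]
  have hcond' : 1 < ((d : ℝ) + 1) * (-(M : ℝ)) + K := by
    rw [hK]; push_cast; linarith
  have hM0 : -(M : ℝ) ≤ 0 := neg_nonpos.2 (Nat.cast_nonneg M)
  refine ⟨K, fun s => E₁.regular K s + E₂.regular K s,
    fun s => (-1) ^ K / (K + 1).factorial * (E₁.rem K s + E₂.rem K s), ?_, ?_, ?_, ?_, ?_⟩
  · linarith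
  · exact (E₁.differentiableOn_regular K hcond).add
      (E₂.differentiableOn_regular K (by rw [hd]; exact hcond))
  · exact ((E₁.differentiableOn_rem K hM0 hcond').add
      (E₂.differentiableOn_rem K hM0 (by rw [hd]; exact hcond'))).const_mul _
  · intro s hs
    have hs' : 2 < ((d : ℝ) + 1) * s.re := by
      rw [div_lt_iff₀ (by positivity)] at hs; linarith
    have hs1 : 1 < (d : ℝ) * s.re := by nlinarith
    have hσ : 0 < s.re := by
      have : (0 : ℝ) < 2 / (d + 1) := by positivity
      linarith
    have hkσ : 1 < (k : ℝ) * s.re := by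
      have : ((d : ℝ) + 1) = 2 * k := by exact_mod_cast hk
      rw [this] at hs'; linarith
    -- the series, indexed by pairs of natural numbers
    set b : ℕ × ℕ → ℂ := fun p =>
      Complex.exp (-s * Real.log (P (p.1 + 1 : ℕ) (p.2 + 1 : ℕ))) with hb
    have hbnorm : ∀ p, ‖b p‖ ≤
        ((p.1 + 1 : ℕ) : ℝ) ^ (-(k * s.re)) * ((p.2 + 1 : ℕ) : ℝ) ^ (-(k * s.re)) := by
      intro p
      have hx : (0 : ℝ) < (p.1 + 1 : ℕ) := by positivity
      have hy : (0 : ℝ) < (p.2 + 1 : ℕ) := by positivity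
      have hle := hP _ _ hx hy
      rw [hb, Complex.norm_exp, Complex.re_mul_ofReal, Complex.neg_re,
        Real.rpow_def_of_pos hx, Real.rpow_def_of_pos hy, ← Real.exp_add, Real.exp_le_exp]
      have h3 := Real.log_le_log (by positivity) hle
      rw [Real.log_pow, Real.log_mul hx.ne' hy.ne'] at h3
      nlinarith
    have hbs : Summable b :=
      Summable.of_norm_bounded ((summable_rpow_succ hkσ).mul_of_nonneg (summable_rpow_succ hkσ)
        (fun _ => by positivity) (fun _ => by positivity)) hbnorm
    have ht₁ : ∀ p : ℕ × ℕ, E₁.term s p.swap = b p * (Real.smoothTransition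
        (3 * (p.1 + 1 : ℕ) / ((p.1 + 1 : ℕ) + (p.2 + 1 : ℕ)) - 1) : ℝ) := by
      intro p
      simp only [hb]
      rw [← h₁ _ _ (by positivity) (by positivity), ← E₁.term_eq]
      rfl
    have ht₂ : ∀ p : ℕ × ℕ, E₂.term s p = b p * (Real.smoothTransition
        (1 - (3 * (p.1 + 1 : ℕ) / ((p.1 + 1 : ℕ) + (p.2 + 1 : ℕ)) - 1)) : ℝ) := by
      intro p
      have hp : ((p.1 + 1 : ℕ) : ℝ) + ((p.2 + 1 : ℕ) : ℝ) ≠ 0 := by positivity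
      have e : 1 - (3 * ((p.1 + 1 : ℕ) : ℝ) / ((p.1 + 1 : ℕ) + (p.2 + 1 : ℕ)) - 1) =
          3 * ((p.2 + 1 : ℕ) : ℝ) / ((p.2 + 1 : ℕ) + (p.1 + 1 : ℕ)) - 1 := by
        rw [add_comm ((p.2 + 1 : ℕ) : ℝ)]
        field_simp
        ring
      simp only [e, hb]
      rw [← h₂ _ _ (by positivity) (by positivity), ← E₂.term_eq]
    have hsw : ∀ (w : ℝ), ‖((Real.smoothTransition w : ℝ) : ℂ)‖ ≤ 1 := by
      intro w
      rw [Complex.norm_of_nonneg (Real.smoothTransition.nonneg w)]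
      exact Real.smoothTransition.le_one w
    have hs₁ : Summable fun p : ℕ × ℕ => E₁.term s p.swap := by
      refine Summable.of_norm_bounded hbs.norm fun p => ?_
      rw [ht₁, norm_mul]
      exact mul_le_of_le_one_right (norm_nonneg _) (hsw _)
    have hs₂ : Summable (E₂.term s) := by
      refine Summable.of_norm_bounded hbs.norm fun p => ?_
      rw [ht₂, norm_mul]
      exact mul_le_of_le_one_right (norm_nonneg _) (hsw _)
    have hs₁' : Summable (E₁.term s) := (Equiv.prodComm ℕ ℕ).summable_iff.1 hs₁
    have hswap : ∑' p : ℕ × ℕ, E₁.term s p.swap = ∑' p, E₁.term s p :=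
      (Equiv.prodComm ℕ ℕ).tsum_eq (E₁.term s)
    have hbsum : ∑' p, b p = ∑' p, E₁.term s p + ∑' p, E₂.term s p := by
      rw [← hswap, ← hs₁.tsum_add hs₂]
      refine tsum_congr fun p => ?_
      rw [ht₁, ht₂, ← mul_add, ← Complex.ofReal_add, smoothTransition_add_one_sub,
        Complex.ofReal_one, mul_one]
    have hne : ((d : ℂ) + 1) * s - 1 ≠ 1 := by
      intro h0
      have := congrArg Complex.re h0
      simp at this
      linarith
    have hval : model d K (poleNumerator E₁ E₂) (fun s => E₁.regular K s + E₂.regular K s)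
        (fun s => (-1) ^ K / (K + 1).factorial * (E₁.rem K s + E₂.rem K s)) s = ∑' p, b p := by
      rw [hbsum, E₁.tsum_term_eq hs1 hs' hs₁' K,
        E₂.tsum_term_eq (by rw [hd]; exact hs1) (by rw [hd]; exact hs') hs₂ K,
        E₁.J_eq hs1 K, E₂.J_eq (by rw [hd]; exact hs1) K, hd, ← hdd,
        riemannZeta_eq_inv_sub_mul hne, model]
      simp only [hdd, ← poleTerm_add E₁ E₂ hd, Finset.sum_add_distrib]
      have : ((E₁.d : ℂ) + 1) * s - 1 - 1 = (E₁.d + 1) * s - 2 := by ring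
      rw [this]
      ring
    rw [hval]
    have hab : a s = b ∘ (Equiv.pnatEquivNat.prodCongr Equiv.pnatEquivNat) := by
      funext p
      have h1 : ∀ q : ℕ+, ((Equiv.pnatEquivNat q + 1 : ℕ) : ℝ) = q := fun q => by
        rw [Equiv.pnatEquivNat_apply, PNat.natPred_add_one]
      rw [ha]
      simp only [hb, Function.comp_apply, Equiv.prodCongr_apply, Prod.map, h1]
    rw [hab]
    exact (Equiv.hasSum_iff _).2 hbs.hasSum
  · have e : (2 / ((d : ℂ) + 1)) = ((2 / ((d : ℝ) + 1) : ℝ) : ℂ) := by push_cast; rfl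
    have hσ : 1 < (d : ℝ) * (2 / (d + 1)) := by
      rw [mul_div_assoc', lt_div_iff₀ (by positivity)]; linarith
    have hσ' : 1 < (d : ℝ) * (((2 / ((d : ℝ) + 1) : ℝ) : ℂ)).re := by
      rw [Complex.ofReal_re]; exact hσ
    have h := add_pos (E₁.J_re_pos hσ) (E₂.J_re_pos (by rw [hd]; exact hσ))
    rw [← Complex.add_re, E₁.J_eq hσ' K, E₂.J_eq (by rw [hd]; exact hσ') K] at h
    simp only [hdd] at e h ⊢
    simp only [e, ← poleTerm_add E₁ E₂ hd, Finset.sum_add_distrib]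
    rwa [add_add_add_comm] at h

end EdgeData

/-! ### Poles of the continuation -/

namespace HasExpansion

variable {d : ℕ} {ψ : ℕ → ℂ → ℂ} {a : ℂ → ℕ+ × ℕ+ → ℂ}

theorem intCast_div_ne (hd : 2 ≤ d) {k : ℤ} (hk : k ≤ 1) : (k : ℂ) / d ≠ 2 / (d + 1) := by
  have hdc : (d : ℂ) ≠ 0 := Nat.cast_ne_zero.2 (by omega)
  have hD : ((d : ℂ) + 1) ≠ 0 := Nat.cast_add_one_ne_zero d
  rw [Ne, div_eq_div_iff hdc hD]
  intro h
  have h' : k * ((d : ℤ) + 1) = 2 * d := by exact_mod_cast h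
  have : (2 : ℤ) ≤ d := by exact_mod_cast hd
  nlinarith

theorem eq_edge_point (hd : 0 < d) {s : ℂ} {i : ℕ} (h : (d : ℂ) * s + 2 * i - 1 = 0) :
    s = ((1 - 2 * i : ℤ) : ℂ) / d := by
  have hdc : (d : ℂ) ≠ 0 := Nat.cast_ne_zero.2 hd.ne'
  rw [eq_div_iff hdc]
  push_cast
  linear_combination h

theorem edge_point_eq (hd : 0 < d) (i : ℕ) :
    (d : ℂ) * (((1 - 2 * i : ℤ) : ℂ) / d) + 2 * i - 1 = 0 := by
  have hdc : (d : ℂ) ≠ 0 := Nat.cast_ne_zero.2 hd.ne'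
  rw [mul_div_cancel₀ _ hdc]
  push_cast
  ring

theorem isRegularAt_of_not_index (h : HasExpansion d ψ a) (hd : 2 ≤ d) {Idx : ℤ → Prop}
    (hIdx : ∀ i : ℕ, ¬ Idx (1 - 2 * i) → ψ i (((1 - 2 * i : ℤ) : ℂ) / d) = 0)
    {W : ℂ → ℂ} (hW : IsMeromorphicContinuation a (2 / (d + 1)) W) {s : ℂ}
    (hs : s ≠ 2 / (d + 1)) (hk : ∀ k : ℤ, k ≤ 1 → Idx k → s ≠ (k : ℂ) / d) : IsRegularAt W s := by
  by_cases hi : ∃ i : ℕ, (d : ℂ) * s + 2 * i - 1 = 0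
  · obtain ⟨i, hi⟩ := hi
    have hsi := eq_edge_point (by omega) hi
    refine (h.local_at_edge_point hW (by omega) hs hi).2 ?_
    have : ¬ Idx (1 - 2 * i) := fun h1 => hk _ (by omega) h1 hsi
    rw [hsi, hIdx i this, mul_zero]
  · push Not at hi
    exact h.isRegularAt hW hs hi

theorem isSimplePoleAt_of_isPoleAt (h : HasExpansion d ψ a) (hd : 2 ≤ d)
    {W : ℂ → ℂ} (hW : IsMeromorphicContinuation a (2 / (d + 1)) W) {s : ℂ} (hs : IsPoleAt W s) :
    IsSimplePoleAt W s := by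
  by_cases h1 : s = 2 / (d + 1)
  · rw [h1]; exact h.isSimplePoleAt_zeta hd hW
  by_cases hi : ∃ i : ℕ, (d : ℂ) * s + 2 * i - 1 = 0
  · obtain ⟨i, hi⟩ := hi
    have hl := h.local_at_edge_point hW (by omega) h1 hi
    by_cases h0 : riemannZeta ((d + 1) * s - 1) * ψ i s = 0
    · exact absurd hs (hl.2 h0).1
    · exact hl.1 h0
  · push Not at hi
    exact absurd hs (h.isRegularAt hW h1 hi).1

/-- The statements about the poles that do not involve the non-vanishing of the coefficients. -/
theorem pole_structure (h : HasExpansion d ψ a) (hd : 2 ≤ d) {Idx : ℤ → Prop}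
    (hIdx : ∀ i : ℕ, ¬ Idx (1 - 2 * i) → ψ i (((1 - 2 * i : ℤ) : ℂ) / d) = 0)
    {W : ℂ → ℂ} (hW : IsMeromorphicContinuation a (2 / (d + 1)) W) :
    (∀ s, IsPoleAt W s → s = 2 / (d + 1) ∨ ∃ k : ℤ, Idx k ∧ s = (k : ℂ) / d) ∧
    ∀ k : ℤ, k ≤ 1 → ¬ Idx k → HasResidueAt W ((k : ℂ) / d) 0 := by
  refine ⟨fun s hs => ?_, fun k hk hk' => ?_⟩
  · by_contra! hcon
    exact (h.isRegularAt_of_not_index hd hIdx hW hcon.1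
      fun k _ hki => hcon.2 k hki).1 hs
  · refine (h.isRegularAt_of_not_index hd hIdx hW (intCast_div_ne hd hk) ?_).2
    intro j _ hj he
    have hdc : (d : ℂ) ≠ 0 := Nat.cast_ne_zero.2 (by omega)
    rw [div_left_inj' hdc] at he
    have : k = j := by exact_mod_cast he
    exact hk' (this ▸ hj)

end HasExpansion

theorem IsSimplePoleAt.isPoleAt {W : ℂ → ℂ} {s : ℂ} (h : IsSimplePoleAt W s) : IsPoleAt W s := by
  refine ⟨h.1, ?_⟩
  rw [h.2]
  exact_mod_cast (by norm_num : (-1 : ℤ) < 0)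

theorem cpow_eq_exp_mul_log {x : ℝ} (hx : 0 < x) (s : ℂ) :
    (x : ℂ) ^ s = Complex.exp (s * Real.log x) := by
  rw [Complex.cpow_def_of_ne_zero (by exact_mod_cast hx.ne'), Complex.ofReal_log hx.le, mul_comm]

namespace EdgeData

/-- At `s = -A` the coefficients are those of the polynomial `r w ^ A` of degree at most `2 A`. -/
theorem coef_neg_natCast (E : EdgeData) {A i : ℕ} (h : 2 * A < i) : E.coef i (-(A : ℂ)) = 0 := by
  rw [coef, Finset.sum_eq_zero, mul_zero]
  intro p hp
  have hp := Finset.HasAntidiagonal.mem_antidiagonal.1 hp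
  by_cases h1 : A < p.1
  · rw [negBinom_neg_natCast h1]; simp
  · rw [negBinom_neg_natCast (j := p.2) (by omega)]; simp

theorem coef_of_b₂_eq_zero (E : EdgeData) (h : E.b₂ = 0) (i : ℕ) (s : ℂ) :
    E.coef i s = Complex.exp (-s * Real.log E.C) * (negBinom s i * (E.b₁ : ℂ) ^ i) := by
  rw [coef, Finset.sum_eq_single (i, 0)]
  · simp [negBinom_zero]
  · intro p hp hne
    have hp := Finset.HasAntidiagonal.mem_antidiagonal.1 hp
    have : p.2 ≠ 0 := fun h0 => hne (Prod.ext (by simp; omega) h0)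
    simp [h, this]
  · intro hn
    exact absurd (Finset.HasAntidiagonal.mem_antidiagonal.2 (by simp)) hn

end EdgeData

/-! ### The series `ω_B` -/

/-- `m (m + n) (m + 2 n)` with `n` fixed, centred at `m = -n`. -/
noncomputable def edgeB₁ : EdgeData where
  d := 3
  a := 1
  C := 1
  b₁ := 1
  b₂ := 0
  d_pos := by norm_num
  half_le_a := by norm_num
  a_le := by norm_num
  C_pos := by norm_num
  b₁_nonneg := by norm_num
  b₁_le := by norm_num
  b₂_nonneg := by norm_num
  b₂_le := by norm_num

/-- `n (m + n) (m + 2 n)` with `m` fixed, centred at `n = -m / 2`. -/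
noncomputable def edgeB₂ : EdgeData where
  d := 3
  a := 1 / 2
  C := 2
  b₁ := 1 / 4
  b₂ := 0
  d_pos := by norm_num
  half_le_a := by norm_num
  a_le := by norm_num
  C_pos := by norm_num
  b₁_nonneg := by norm_num
  b₁_le := by norm_num
  b₂_nonneg := by norm_num
  b₂_le := by norm_num

theorem omegaBTerm_eq (s : ℂ) (p : ℕ+ × ℕ+) : omegaBTerm s p = Complex.exp
    (-s * Real.log ((p.1 : ℝ) * p.2 * (p.1 + p.2) * (p.1 + 2 * p.2))) := by
  have hx : (0 : ℝ) < (p.1 : ℕ) := by exact_mod_cast p.1.pos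
  have hy : (0 : ℝ) < (p.2 : ℕ) := by exact_mod_cast p.2.pos
  have e : omegaBTerm s p = 1 / ((((p.1 : ℕ) : ℝ) : ℂ) ^ s * (((p.2 : ℕ) : ℝ) : ℂ) ^ s *
      (((p.1 : ℕ) + (p.2 : ℕ) : ℝ) : ℂ) ^ s * (((p.1 : ℕ) + 2 * (p.2 : ℕ) : ℝ) : ℂ) ^ s) := by
    rw [omegaBTerm]; push_cast; rfl
  generalize ((p.1 : ℕ) : ℝ) = x at *
  generalize ((p.2 : ℕ) : ℝ) = y at *
  rw [e, cpow_eq_exp_mul_log hx, cpow_eq_exp_mul_log hy, cpow_eq_exp_mul_log (by positivity),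
    cpow_eq_exp_mul_log (by positivity), ← Complex.exp_add, ← Complex.exp_add, ← Complex.exp_add,
    one_div, ← Complex.exp_neg, Real.log_mul (by positivity) (by positivity),
    Real.log_mul (by positivity) (by positivity), Real.log_mul (by positivity) (by positivity)]
  congr 1
  push_cast
  ring

theorem hasExpansion_omegaB :
    HasExpansion 3 (EdgeData.poleNumerator edgeB₁ edgeB₂) omegaBTerm := by
  refine EdgeData.hasExpansion_of_edges edgeB₁ edgeB₂ rfl (by norm_num [edgeB₁])
    (P := fun x y => x * y * (x + y) * (x + 2 * y)) (k := 2) ?_ ?_ rfl ?_ omegaBTerm_eq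
  · intro x y hx hy
    have : 0 < x / y + 1 := by positivity
    simp only [EdgeData.form, edgeB₁]
    field_simp
    ring
  · intro x y hx hy
    have : 0 < y / x + 1 / 2 := by positivity
    simp only [EdgeData.form, edgeB₂]
    field_simp
    ring
  · intro x y hx hy
    have h : x * y ≤ (x + y) * (x + 2 * y) := by nlinarith [mul_pos hx hy]
    calc (x * y) ^ 2 = x * y * (x * y) := by ring
      _ ≤ x * y * ((x + y) * (x + 2 * y)) := by gcongr
      _ = x * y * (x + y) * (x + 2 * y) := by ring

/-- The two edges contribute positive multiples of the same binomial coefficient. -/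
theorem poleNumerator_B (i : ℕ) :
    EdgeData.poleNumerator edgeB₁ edgeB₂ i (((1 - 2 * i : ℤ) : ℂ) / (3 : ℕ)) =
      negBinom (((1 - 2 * i : ℤ) : ℂ) / (3 : ℕ)) i *
        ((1 + Real.exp (-((1 - 2 * i : ℤ) / 3 : ℝ) * Real.log 2) * (1 / 4) ^ i : ℝ) : ℂ) := by
  rw [EdgeData.poleNumerator_eq edgeB₁ edgeB₂ rfl
    (s := ((1 - 2 * i : ℤ) : ℂ) / (3 : ℕ)) (HasExpansion.edge_point_eq edgeB₁.d_pos i),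
    EdgeData.coef_of_b₂_eq_zero _ rfl, EdgeData.coef_of_b₂_eq_zero _ rfl]
  simp only [edgeB₁, edgeB₂, Real.log_one]
  push_cast
  simp
  ring

/-- The excluded odd indices are the multiples of `3`, where `s` is a negative integer. -/
theorem not_indexB_iff {i : ℕ} : ¬ IndexB (1 - 2 * i) ↔ ∃ A : ℕ, 2 * i = 1 + 3 * A := by
  unfold IndexB Int.ModEq
  constructor
  · intro h
    exact ⟨(2 * i - 1) / 3, by omega⟩
  · rintro ⟨A, hA⟩
    omega

theorem poleNumerator_B_eq_zero {i : ℕ} (h : ¬ IndexB (1 - 2 * i)) :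
    EdgeData.poleNumerator edgeB₁ edgeB₂ i (((1 - 2 * i : ℤ) : ℂ) / (3 : ℕ)) = 0 := by
  obtain ⟨A, hA⟩ := not_indexB_iff.1 h
  have e : (((1 - 2 * i : ℤ) : ℂ) / (3 : ℕ)) = -(A : ℂ) := by
    have : (2 * i : ℂ) = 1 + 3 * A := by exact_mod_cast hA
    push_cast
    rw [this]
    ring
  rw [poleNumerator_B, e, negBinom_neg_natCast (by omega), zero_mul]

theorem poleNumerator_B_ne_zero {i : ℕ} (h : IndexB (1 - 2 * i)) :
    EdgeData.poleNumerator edgeB₁ edgeB₂ i (((1 - 2 * i : ℤ) : ℂ) / (3 : ℕ)) ≠ 0 := by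
  rw [poleNumerator_B]
  refine mul_ne_zero (negBinom_ne_zero fun l _ he => ?_) ?_
  · refine (not_indexB_iff.2 ⟨l, ?_⟩) h
    have h3 : (1 - 2 * i : ℂ) = -l * 3 := by
      rw [← div_eq_iff (by norm_num), ← he]
      push_cast
      ring
    have : (1 - 2 * i : ℤ) = -l * 3 := by exact_mod_cast h3
    omega
  · rw [Complex.ofReal_ne_zero]
    positivity

theorem zeta_ne_zero_of_indexB {k : ℤ} (h : IndexB k) :
    riemannZeta (((3 : ℕ) + 1) * ((k : ℂ) / (3 : ℕ)) - 1) ≠ 0 := by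
  have e : (((3 : ℕ) : ℂ) + 1) * ((k : ℂ) / (3 : ℕ)) - 1 = (((4 * k - 3) / 3 : ℝ) : ℂ) := by
    push_cast
    ring
  rw [e]
  by_cases hk : k = 1
  · rw [hk]
    exact riemannZeta_ne_zero_of_mem_Ioo (by norm_num) (by norm_num)
  · have hk1 : k ≤ 0 := by have := h.1; omega
    have hkR : (k : ℝ) ≤ 0 := by exact_mod_cast hk1
    refine riemannZeta_ne_zero_of_neg (by linarith) fun n hn => ?_
    rw [div_eq_iff (by norm_num)] at hn
    have : 4 * k - 3 = n * 3 := by exact_mod_cast hn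
    unfold IndexB Int.ModEq at h
    omega

/-! ### The series `ω_G` -/

/-- `m (m + n) (m + 2 n) (m + 3 n) (2 m + 3 n)` with `n` fixed, centred at `m = -3 n / 2`. -/
noncomputable def edgeG₁ : EdgeData where
  d := 5
  a := 3 / 2
  C := 2
  b₁ := 1 / 4
  b₂ := 9 / 4
  d_pos := by norm_num
  half_le_a := by norm_num
  a_le := by norm_num
  C_pos := by norm_num
  b₁_nonneg := by norm_num
  b₁_le := by norm_num
  b₂_nonneg := by norm_num
  b₂_le := by norm_num

/-- `n (m + n) (m + 2 n) (m + 3 n) (2 m + 3 n)` with `m` fixed, centred at `n = -m / 2`. -/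
noncomputable def edgeG₂ : EdgeData where
  d := 5
  a := 1 / 2
  C := 18
  b₁ := 1 / 4
  b₂ := 1 / 36
  d_pos := by norm_num
  half_le_a := by norm_num
  a_le := by norm_num
  C_pos := by norm_num
  b₁_nonneg := by norm_num
  b₁_le := by norm_num
  b₂_nonneg := by norm_num
  b₂_le := by norm_num

theorem omegaGTerm_eq (s : ℂ) (p : ℕ+ × ℕ+) : omegaGTerm s p = Complex.exp
    (-s * Real.log ((p.1 : ℝ) * p.2 * (p.1 + p.2) * (p.1 + 2 * p.2) * (p.1 + 3 * p.2) *
      (2 * p.1 + 3 * p.2))) := by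
  have hx : (0 : ℝ) < (p.1 : ℕ) := by exact_mod_cast p.1.pos
  have hy : (0 : ℝ) < (p.2 : ℕ) := by exact_mod_cast p.2.pos
  have e : omegaGTerm s p = 1 / ((((p.1 : ℕ) : ℝ) : ℂ) ^ s * (((p.2 : ℕ) : ℝ) : ℂ) ^ s *
      (((p.1 : ℕ) + (p.2 : ℕ) : ℝ) : ℂ) ^ s * (((p.1 : ℕ) + 2 * (p.2 : ℕ) : ℝ) : ℂ) ^ s *
      (((p.1 : ℕ) + 3 * (p.2 : ℕ) : ℝ) : ℂ) ^ s *
      ((2 * (p.1 : ℕ) + 3 * (p.2 : ℕ) : ℝ) : ℂ) ^ s) := by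
    rw [omegaGTerm]; push_cast; rfl
  generalize ((p.1 : ℕ) : ℝ) = x at *
  generalize ((p.2 : ℕ) : ℝ) = y at *
  rw [e, cpow_eq_exp_mul_log hx, cpow_eq_exp_mul_log hy, cpow_eq_exp_mul_log (by positivity),
    cpow_eq_exp_mul_log (by positivity), cpow_eq_exp_mul_log (by positivity),
    cpow_eq_exp_mul_log (by positivity), ← Complex.exp_add, ← Complex.exp_add, ← Complex.exp_add,
    ← Complex.exp_add, ← Complex.exp_add, one_div, ← Complex.exp_neg,
    Real.log_mul (by positivity) (by positivity), Real.log_mul (by positivity) (by positivity),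
    Real.log_mul (by positivity) (by positivity), Real.log_mul (by positivity) (by positivity),
    Real.log_mul (by positivity) (by positivity)]
  congr 1
  push_cast
  ring

theorem hasExpansion_omegaG :
    HasExpansion 5 (EdgeData.poleNumerator edgeG₁ edgeG₂) omegaGTerm := by
  refine EdgeData.hasExpansion_of_edges edgeG₁ edgeG₂ rfl (by norm_num [edgeG₁])
    (P := fun x y => x * y * (x + y) * (x + 2 * y) * (x + 3 * y) * (2 * x + 3 * y)) (k := 3)
    ?_ ?_ rfl ?_ omegaGTerm_eq
  · intro x y hx hy
    have : 0 < x / y + 3 / 2 := by positivity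
    simp only [EdgeData.form, edgeG₁]
    field_simp
    ring
  · intro x y hx hy
    have : 0 < y / x + 1 / 2 := by positivity
    simp only [EdgeData.form, edgeG₂]
    field_simp
    ring
  · intro x y hx hy
    have h : x * y ≤ (x + y) * (x + 2 * y) := by nlinarith [mul_pos hx hy]
    have h' : x * y ≤ (x + 3 * y) * (2 * x + 3 * y) := by nlinarith [mul_pos hx hy]
    calc (x * y) ^ 3 = x * y * (x * y) * (x * y) := by ring
      _ ≤ x * y * ((x + y) * (x + 2 * y)) * ((x + 3 * y) * (2 * x + 3 * y)) := by gcongr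
      _ = x * y * (x + y) * (x + 2 * y) * (x + 3 * y) * (2 * x + 3 * y) := by ring

/-- The excluded odd indices are the multiples of `5`, where `s` is a negative integer. -/
theorem poleNumerator_G_eq_zero {i : ℕ} (h : ¬ IndexG (1 - 2 * i)) :
    EdgeData.poleNumerator edgeG₁ edgeG₂ i (((1 - 2 * i : ℤ) : ℂ) / (5 : ℕ)) = 0 := by
  obtain ⟨A, hA⟩ : ∃ A : ℕ, 2 * i = 1 + 5 * A := by
    unfold IndexG Int.ModEq at h
    exact ⟨(2 * i - 1) / 5, by omega⟩
  have e : (((1 - 2 * i : ℤ) : ℂ) / (5 : ℕ)) = -(A : ℂ) := by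
    have : (2 * i : ℂ) = 1 + 5 * A := by exact_mod_cast hA
    push_cast
    rw [this]
    ring
  rw [EdgeData.poleNumerator_eq edgeG₁ edgeG₂ rfl
    (s := ((1 - 2 * i : ℤ) : ℂ) / (5 : ℕ)) (HasExpansion.edge_point_eq edgeG₁.d_pos i), e,
    EdgeData.coef_neg_natCast _ (by omega), EdgeData.coef_neg_natCast _ (by omega), add_zero]

theorem mainTheorem7 :
    ((∃ W : ℂ → ℂ, IsMeromorphicContinuation omegaBTerm (1 / 2) W) ∧
      ∀ W : ℂ → ℂ, IsMeromorphicContinuation omegaBTerm (1 / 2) W →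
        (∀ s : ℂ, IsPoleAt W s ↔ (s = 1 / 2 ∨ ∃ k : ℤ, IndexB k ∧ s = (k : ℂ) / 3)) ∧
        (∀ s : ℂ, IsPoleAt W s → IsSimplePoleAt W s) ∧
        (∀ k : ℤ, k ≤ 1 → ¬ IndexB k → HasResidueAt W ((k : ℂ) / 3) 0)) ∧
    ((∃ W : ℂ → ℂ, IsMeromorphicContinuation omegaGTerm (1 / 3) W) ∧
      ∀ W : ℂ → ℂ, IsMeromorphicContinuation omegaGTerm (1 / 3) W →
        IsPoleAt W (1 / 3) ∧
        (∀ s : ℂ, IsPoleAt W s → (s = 1 / 3 ∨ ∃ k : ℤ, IndexG k ∧ s = (k : ℂ) / 5)) ∧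
        (∀ s : ℂ, IsPoleAt W s → IsSimplePoleAt W s) ∧
        (∀ k : ℤ, k ≤ 1 → ¬ IndexG k → HasResidueAt W ((k : ℂ) / 5) 0)) := by
  have hB := hasExpansion_omegaB
  have hG := hasExpansion_omegaG
  have eB : (1 / 2 : ℝ) = 2 / ((3 : ℕ) + 1) := by norm_num
  have eB' : (1 / 2 : ℂ) = 2 / ((3 : ℕ) + 1) := by norm_num
  have eG : (1 / 3 : ℝ) = 2 / ((5 : ℕ) + 1) := by norm_num
  have eG' : (1 / 3 : ℂ) = 2 / ((5 : ℕ) + 1) := by norm_num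
  have c3 : (3 : ℂ) = (3 : ℕ) := by norm_num
  have c5 : (5 : ℂ) = (5 : ℕ) := by norm_num
  constructor
  · rw [eB, eB']
    refine ⟨hB.exists_continuation, fun W hW => ?_⟩
    have hst := hB.pole_structure (by norm_num) (fun i => poleNumerator_B_eq_zero) hW
    rw [c3]
    refine ⟨fun s => ⟨hst.1 s, ?_⟩, fun s => hB.isSimplePoleAt_of_isPoleAt (by norm_num) hW, hst.2⟩
    rintro (rfl | ⟨k, hk, rfl⟩)
    · exact (hB.isSimplePoleAt_zeta (by norm_num) hW).isPoleAt
    · obtain ⟨i, rfl⟩ : ∃ i : ℕ, k = 1 - 2 * i := by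
        unfold IndexB Int.ModEq at hk
        exact ⟨((1 - k) / 2).toNat, by omega⟩
      refine ((hB.local_at_edge_point hW (by norm_num)
        (HasExpansion.intCast_div_ne (by norm_num) hk.1)
        (HasExpansion.edge_point_eq (by norm_num) i)).1 ?_).isPoleAt
      exact mul_ne_zero (zeta_ne_zero_of_indexB hk) (poleNumerator_B_ne_zero hk)
  · rw [eG, eG']
    refine ⟨hG.exists_continuation, fun W hW => ?_⟩
    have hst := hG.pole_structure (by norm_num) (fun i => poleNumerator_G_eq_zero) hW
    rw [c5]
    exact ⟨(hG.isSimplePoleAt_zeta (by norm_num) hW).isPoleAt, hst.1,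
      fun s => hG.isSimplePoleAt_of_isPoleAt (by norm_num) hW, hst.2⟩
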